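/- Let $G=\mathrm{PSL}_2(\mathbb{R})$, acting on the upper half-plane $\mathbb{H}$ by Möbius transformations. A modular embedding is a pair $(p,\rho)$ consisting of a group homomorphism $\rho:\Gamma\to G$ from a lattice $\Gamma\le G$ (a discrete subgroup admitting a fundamental domain of finite hyperbolic area in $\mathbb{H}$) and a holomorphic map $p:\mathbb{H}\to\mathbb{H}$ with $p(\gamma z)=\rho(\gamma)p(z)$ for all $\gamma\in\Gamma$, $z\in\mathbb{H}$. Two modular embeddings $(p_i,\rho_i)$ with domains $\Gamma_i$ ($i=1,2$) are called commensurable if $\rho_1$ and $\rho_2$ agree on some subgroup $\Gamma'$ of $\Gamma_1\cap\Gamma_2$ that has finite index in both $\Gamma_1$ and $\Gamma_2$. For $(g,h)\in G\times G$ put \[ g(p,\rho)h^{-1}:=(g\circ p\circ h^{-1},\ c_g\circ\rho\circ c_{h^{-1}}),\qquad c_g(x)=gxg^{-1}, \] a modular embedding with domain $h\Gamma h^{-1}$, and let \[ \mathrm{Comm}(p,\rho):=\{(g,h)\in G\times G : (p,\rho)\text{ and } g(p,\rho)h^{-1}\text{ are commensurable}\}, \] which is a subgroup of $G\times G$. Let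 $(p,\rho)$ be a modular embedding such that $p$ is non-constant and $\rho$ has a nontrivial kernel. Then $\Gamma$, embedded by $\gamma\mapsto(\rho(\gamma),\gamma)$, is a subgroup of finite index of $\mathrm{Comm}(p,\rho)$. -/

import Mathlib

open scoped MatrixGroups UpperHalfPlane Pointwise Manifold

noncomputable section

/-! ### The action of `PSL(2, ℝ)` on the upper half-plane by Möbius transformations -/

namespace PSLAction

theorem center_smul (c : SL(2, ℝ)) (hc : c ∈ Subgroup.center SL(2, ℝ)) (z : ℍ) : c • z = z := by
  obtain ⟨r, hr, hrc⟩ := Matrix.SpecialLinearGroup.mem_center_iff.mp hc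
  have hr2 : r * r = 1 := by
    have : r ^ 2 = 1 := by simpa using hr
    nlinarith
  have hr0 : r ≠ 0 := by
    rintro rfl
    simp at hr2
  have h00 : c 0 0 = r := by simp [← hrc]
  have h01 : c 0 1 = 0 := by simp [← hrc]
  have h10 : c 1 0 = 0 := by simp [← hrc]
  have h11 : c 1 1 = r := by simp [← hrc]
  apply UpperHalfPlane.ext_re_im
  all_goals
    rw [UpperHalfPlane.specialLinearGroup_apply]
    simp [h00, h01, h10, h11, hr0]

/-- The homomorphism from `PSL(2, ℝ)` to the permutations of `ℍ` induced by the action of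
`SL(2, ℝ)`. -/
def toPerm : PSL(2, ℝ) →* Equiv.Perm ℍ :=
  QuotientGroup.lift (Subgroup.center SL(2, ℝ)) (MulAction.toPermHom SL(2, ℝ) ℍ)
    (fun c hc => Equiv.ext fun z => center_smul c hc z)

/-- `PSL(2, ℝ)` acts on `ℍ` by Möbius transformations. -/
instance : MulAction PSL(2, ℝ) ℍ := MulAction.compHom ℍ toPerm

theorem mk_smul (g : SL(2, ℝ)) (z : ℍ) :
    (QuotientGroup.mk g : PSL(2, ℝ)) • z = g • z := rfl

theorem measurePreserving (g : PSL(2, ℝ)) :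
    MeasureTheory.MeasurePreserving (fun z : ℍ => g • z) := by
  obtain ⟨g, rfl⟩ := QuotientGroup.mk_surjective g
  exact MeasureTheory.measurePreserving_smul (g : GL (Fin 2) ℝ)
    (MeasureTheory.volume : MeasureTheory.Measure ℍ)

theorem mdifferentiable (g : PSL(2, ℝ)) : MDifferentiable 𝓘(ℂ) 𝓘(ℂ) (fun z : ℍ => g • z) := by
  obtain ⟨g, rfl⟩ := QuotientGroup.mk_surjective g
  exact UpperHalfPlane.mdifferentiable_smul (g := (g : GL (Fin 2) ℝ)) (by simp)

end PSLAction

/-! ### Lattices -/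

/-- A lattice in `PSL(2, ℝ)` (cofinite Fuchsian group): a discrete subgroup, for the quotient
topology of `PSL(2, ℝ)`, that has a fundamental domain of finite hyperbolic area in `ℍ`. The measure
`volume` on `ℍ` is `dx dy / y ^ 2`. -/
structure IsFuchsianLattice (Γ : Subgroup PSL(2, ℝ)) : Prop where
  discrete : DiscreteTopology Γ
  cofinite : ∃ F : Set ℍ, MeasureTheory.IsFundamentalDomain Γ F ∧ MeasureTheory.volume F < ⊤

theorem mem_conj_smul (h x : PSL(2, ℝ)) (Γ : Subgroup PSL(2, ℝ)) :
    x ∈ MulAut.conj h • Γ ↔ h⁻¹ * x * h ∈ Γ := by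
  rw [Subgroup.mem_pointwise_smul_iff_inv_smul_mem, ← map_inv]
  simp

theorem IsFuchsianLattice.conj {Γ : Subgroup PSL(2, ℝ)} (hΓ : IsFuchsianLattice Γ)
    (h : PSL(2, ℝ)) : IsFuchsianLattice (MulAut.conj h • Γ) := by
  obtain ⟨hd, F, hF, hvol⟩ := hΓ
  let toΓ : (MulAut.conj h • Γ : Subgroup PSL(2, ℝ)) → Γ :=
    fun x => ⟨h⁻¹ * x * h, (mem_conj_smul h x Γ).mp x.2⟩
  refine ⟨?_, (fun z : ℍ => h⁻¹ • z) ⁻¹' F, ?_, ?_⟩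
  · refine DiscreteTopology.of_continuous_injective (f := toΓ) ?_ ?_
    · exact Continuous.subtype_mk (by fun_prop) _
    · intro x y hxy
      have : h⁻¹ * (x : PSL(2, ℝ)) * h = h⁻¹ * y * h := congrArg Subtype.val hxy
      exact Subtype.ext (by simpa using this)
  · refine hF.preimage_of_equiv (PSLAction.measurePreserving h⁻¹).quasiMeasurePreserving
      (e := fun γ : Γ => (⟨h * γ * h⁻¹, (mem_conj_smul h _ Γ).mpr (by simp [mul_assoc])⟩ :
        (MulAut.conj h • Γ : Subgroup PSL(2, ℝ)))) ?_ ?_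
    · refine Function.bijective_iff_has_inverse.mpr ⟨toΓ, fun x => ?_, fun x => ?_⟩
      · exact Subtype.ext (by simp [toΓ, mul_assoc])
      · exact Subtype.ext (by simp [toΓ, mul_assoc])
    · intro γ z
      change h⁻¹ • (h * (γ : PSL(2, ℝ)) * h⁻¹) • z = (γ : PSL(2, ℝ)) • h⁻¹ • z
      simp [smul_smul, mul_assoc]
  · rw [(PSLAction.measurePreserving h⁻¹).measure_preimage hF.nullMeasurableSet]
    exact hvol

/-! ### Modular embeddings -/

/-- A modular embedding `(p, ρ)`: a homomorphism `ρ : Γ → PSL(2, ℝ)` from a lattice `Γ = dom ρ`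
in `PSL(2, ℝ)` and a `ρ`-equivariant holomorphic map `p : ℍ → ℍ`. -/
structure ModularEmbedding where
  /-- the domain `Γ` of `ρ` -/
  dom : Subgroup PSL(2, ℝ)
  isLattice : IsFuchsianLattice dom
  /-- the homomorphism `ρ` -/
  rho : dom →* PSL(2, ℝ)
  /-- the map `p` -/
  p : ℍ → ℍ
  holomorphic : MDifferentiable 𝓘(ℂ) 𝓘(ℂ) p
  equivariant : ∀ (γ : dom) (z : ℍ), p ((γ : PSL(2, ℝ)) • z) = rho γ • p z

namespace ModularEmbedding

/-- The modular embedding `g (p, ρ) h⁻¹ = (g ∘ p ∘ h⁻¹, c_g ∘ ρ ∘ c_{h⁻¹})`, where `c_g` is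
conjugation `x ↦ g x g⁻¹`; its domain is `h Γ h⁻¹`. -/
def act (g h : PSL(2, ℝ)) (E : ModularEmbedding) : ModularEmbedding where
  dom := MulAut.conj h • E.dom
  isLattice := E.isLattice.conj h
  rho :=
    { toFun := fun x => g * E.rho ⟨h⁻¹ * x * h, (mem_conj_smul h x E.dom).mp x.2⟩ * g⁻¹
      map_one' := by
        have : (⟨h⁻¹ * ((1 : (MulAut.conj h • E.dom : Subgroup PSL(2, ℝ))) : PSL(2, ℝ)) * h,
            (mem_conj_smul h _ E.dom).mp (Subtype.prop _)⟩ : E.dom) = 1 :=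
          Subtype.ext (by simp)
        rw [this]
        simp
      map_mul' := fun x y => by
        have : (⟨h⁻¹ * ((x * y : (MulAut.conj h • E.dom : Subgroup PSL(2, ℝ))) : PSL(2, ℝ)) * h,
            (mem_conj_smul h _ E.dom).mp (Subtype.prop _)⟩ : E.dom) =
            ⟨h⁻¹ * x * h, (mem_conj_smul h x E.dom).mp x.2⟩ *
            ⟨h⁻¹ * y * h, (mem_conj_smul h y E.dom).mp y.2⟩ :=
          Subtype.ext (by simp [mul_assoc])
        rw [this, map_mul]
        simp [mul_assoc] }
  p := fun z => g • E.p (h⁻¹ • z)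
  holomorphic := (PSLAction.mdifferentiable g).comp
    (E.holomorphic.comp (PSLAction.mdifferentiable h⁻¹))
  equivariant := fun γ z => by
    have := E.equivariant ⟨h⁻¹ * γ * h, (mem_conj_smul h γ E.dom).mp γ.2⟩ (h⁻¹ • z)
    simp only [smul_smul, mul_assoc, mul_inv_cancel, mul_one] at this
    simp [smul_smul, mul_assoc, this]

/-- Two modular embeddings are commensurable if their homomorphisms agree on a common subgroup
that has finite index in both domains. -/
def Commensurable (E₁ E₂ : ModularEmbedding) : Prop :=
  ∃ (Γ' : Subgroup PSL(2, ℝ)) (h₁ : Γ' ≤ E₁.dom) (h₂ : Γ' ≤ E₂.dom),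
    Γ'.IsFiniteRelIndex E₁.dom ∧ Γ'.IsFiniteRelIndex E₂.dom ∧
    ∀ (x : PSL(2, ℝ)) (hx : x ∈ Γ'), E₁.rho ⟨x, h₁ hx⟩ = E₂.rho ⟨x, h₂ hx⟩

theorem rho_congr (E : ModularEmbedding) {x y : PSL(2, ℝ)} (hx : x ∈ E.dom) (hxy : x = y) :
    E.rho ⟨x, hx⟩ = E.rho ⟨y, hxy ▸ hx⟩ := by
  subst hxy
  rfl

/-- The commensurator `Comm(p, ρ)`: the group of all `(g, h)` such that `(p, ρ)` and
`g (p, ρ) h⁻¹` are commensurable. -/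
def comm (E : ModularEmbedding) : Subgroup (PSL(2, ℝ) × PSL(2, ℝ)) where
  carrier := {x | Commensurable E (act x.1 x.2 E)}
  one_mem' := by
    refine ⟨E.dom, le_rfl, ?_, ⟨by simp⟩, ⟨?_⟩, ?_⟩
    · intro x hx
      exact (mem_conj_smul _ _ _).mpr (by simpa using hx)
    · simp [act]
    · intro x hx
      change E.rho ⟨x, _⟩ = 1 * E.rho ⟨1⁻¹ * x * 1, _⟩ * 1⁻¹
      rw [E.rho_congr hx (show x = 1⁻¹ * x * 1 by simp)]
      simp
  mul_mem' := by
    rintro ⟨g₁, h₁⟩ ⟨g₂, h₂⟩ ⟨Γ₁, a₁, b₁, ⟨i₁⟩, ⟨j₁⟩, r₁⟩ ⟨Γ₂, a₂, b₂, ⟨i₂⟩, ⟨j₂⟩, r₂⟩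
    change Γ₁ ≤ MulAut.conj h₁ • E.dom at b₁
    change Γ₂ ≤ MulAut.conj h₂ • E.dom at b₂
    change Γ₁.relIndex (MulAut.conj h₁ • E.dom) ≠ 0 at j₁
    change Γ₂.relIndex (MulAut.conj h₂ • E.dom) ≠ 0 at j₂
    have c₁ : (MulAut.conj h₁ • Γ₂).relIndex (MulAut.conj h₁ • E.dom) ≠ 0 := by
      rwa [Subgroup.relIndex_pointwise_smul]
    have c₂ : (MulAut.conj h₁ • Γ₂).relIndex (MulAut.conj (h₁ * h₂) • E.dom) ≠ 0 := by
      rwa [map_mul, mul_smul, Subgroup.relIndex_pointwise_smul]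
    have c₃ : (Γ₁ ⊓ MulAut.conj h₁ • Γ₂).relIndex (MulAut.conj h₁ • E.dom) ≠ 0 :=
      Subgroup.relIndex_inf_ne_zero j₁ c₁
    have c₄ : (Γ₁ ⊓ MulAut.conj h₁ • Γ₂).relIndex Γ₁ ≠ 0 :=
      mt (Subgroup.relIndex_eq_zero_of_le_right b₁) c₃
    have c₅ : (Γ₁ ⊓ MulAut.conj h₁ • Γ₂).relIndex (MulAut.conj h₁ • Γ₂) ≠ 0 := by
      refine mt (Subgroup.relIndex_eq_zero_of_le_right ?_) c₃
      exact Subgroup.pointwise_smul_le_pointwise_smul_iff.mpr a₂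
    refine ⟨Γ₁ ⊓ MulAut.conj h₁ • Γ₂, inf_le_left.trans a₁, ?_,
      ⟨Subgroup.relIndex_ne_zero_trans c₄ i₁⟩, ⟨Subgroup.relIndex_ne_zero_trans c₅ c₂⟩, ?_⟩
    · rintro x ⟨-, hx⟩
      have := b₂ ((mem_conj_smul _ _ _).mp hx)
      rw [mem_conj_smul] at this
      exact (mem_conj_smul _ _ _).mpr (by simpa [mul_assoc] using this)
    · rintro x ⟨hx₁, hx₂⟩
      have e₁ : E.rho ⟨x, a₁ hx₁⟩ =
          g₁ * E.rho ⟨h₁⁻¹ * x * h₁, (mem_conj_smul _ _ _).mp (b₁ hx₁)⟩ * g₁⁻¹ := r₁ x hx₁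
      have hx₂' := (mem_conj_smul _ _ _).mp hx₂
      have hx₃ := (mem_conj_smul _ _ _).mp (b₂ hx₂')
      have e₂ : E.rho ⟨h₁⁻¹ * x * h₁, a₂ hx₂'⟩ =
          g₂ * E.rho ⟨h₂⁻¹ * (h₁⁻¹ * x * h₁) * h₂, hx₃⟩ * g₂⁻¹ := r₂ _ hx₂'
      change E.rho ⟨x, _⟩ = g₁ * g₂ * E.rho ⟨(h₁ * h₂)⁻¹ * x * (h₁ * h₂), _⟩ * (g₁ * g₂)⁻¹
      rw [e₁, e₂, E.rho_congr hx₃ (show _ = (h₁ * h₂)⁻¹ * x * (h₁ * h₂) by simp [mul_assoc])]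
      simp [mul_assoc]
  inv_mem' := by
    rintro ⟨g, h⟩ ⟨Γ', a, b, ⟨i⟩, ⟨j⟩, r⟩
    change Γ' ≤ MulAut.conj h • E.dom at b
    change Γ'.relIndex (MulAut.conj h • E.dom) ≠ 0 at j
    have a' : MulAut.conj h⁻¹ • Γ' ≤ MulAut.conj h⁻¹ • E.dom :=
      Subgroup.pointwise_smul_le_pointwise_smul_iff.mpr a
    have b' : MulAut.conj h⁻¹ • Γ' ≤ E.dom := by
      have := (Subgroup.pointwise_smul_le_pointwise_smul_iff (a := MulAut.conj h⁻¹)).mpr b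
      rwa [smul_smul, ← map_mul, inv_mul_cancel, map_one, one_smul] at this
    refine ⟨MulAut.conj h⁻¹ • Γ', b', a', ⟨?_⟩, ⟨?_⟩, ?_⟩
    · rwa [← Subgroup.relIndex_pointwise_smul (MulAut.conj h), smul_smul, ← map_mul,
        mul_inv_cancel, map_one, one_smul]
    · change (MulAut.conj h⁻¹ • Γ').relIndex (MulAut.conj h⁻¹ • E.dom) ≠ 0
      rwa [Subgroup.relIndex_pointwise_smul]
    · intro x hx
      have hx' := (mem_conj_smul _ _ _).mp hx
      have hx'' := (mem_conj_smul _ _ _).mp (b hx')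
      have e : E.rho ⟨h⁻¹⁻¹ * x * h⁻¹, a hx'⟩ =
          g * E.rho ⟨h⁻¹ * (h⁻¹⁻¹ * x * h⁻¹) * h, hx''⟩ * g⁻¹ := r _ hx'
      change E.rho ⟨x, _⟩ = g⁻¹ * E.rho ⟨h⁻¹⁻¹ * x * h⁻¹, _⟩ * g⁻¹⁻¹
      rw [e, E.rho_congr hx'' (show _ = x by simp [mul_assoc])]
      simp [mul_assoc]

theorem mem_comm (E : ModularEmbedding) (g h : PSL(2, ℝ)) :
    (g, h) ∈ E.comm ↔ Commensurable E (act g h E) := Iff.rfl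

/-- The embedding `γ ↦ (ρ(γ), γ)` of `Γ = dom ρ` into `PSL(2, ℝ) × PSL(2, ℝ)`. -/
def domEmb (E : ModularEmbedding) : E.dom →* PSL(2, ℝ) × PSL(2, ℝ) :=
  E.rho.prod E.dom.subtype

end ModularEmbedding

end

noncomputable section

open MeasureTheory Filter Topology

/-! ### The action on `ℍ` by area-preserving isometries -/

namespace PSLAction

/-! Everything rests on a rigidity principle, `eq_of_dist_invariant`: if p is non-constant and
holomorphic, q is holomorphic, and the distance between p z and q z is invariant under a group of
finite covolume, then p = q. Indeed tanh(dist(p z, q z)/4) is bounded and subharmonic, so it is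
constant by finiteness of the area, and a constant positive distance is excluded by the maximum
principle.

For (g, h) in the commensurator, p and g ∘ p ∘ h⁻¹ are equivariant for the same homomorphism on a
finite-index subgroup of Γ, hence equal: p ∘ h = g ∘ p (`p_smul_of_mem_comm`). Since p is
non-constant, h determines g. The index in question is therefore that of Γ in the projection of the
commensurator to the second factor, and this projection lies in the image of the group N of
semi-invariants of p.

It remains to see that N is discrete; a comparison of areas then bounds the index. The group K of
invariants of p is discrete by the identity theorem, is normalized by N, and contains a noncentral k
because ρ has a kernel. If N were not discrete, elements of N close to 1 would commute with k and
with any given N-conjugate of k. So N would preserve the line spanned by the traceless part X of k,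
and by discreteness of K it would act there by ±1. Every γ in N would then commute with or invert
each c of determinant 1 of the form b + sX, so the distance between p ∘ c and p ∘ c⁻¹ would be
Γ-invariant. Rigidity gives c² ∈ K, which fails for small s ≠ 0
(`eventually_eq_one_of_mem_semiInvariants`). -/

instance : IsIsometricSMul PSL(2, ℝ) ℍ := ⟨fun g => by
  obtain ⟨g, rfl⟩ := QuotientGroup.mk_surjective g
  exact isometry_smul ℍ g⟩

instance : ContinuousConstSMul PSL(2, ℝ) ℍ := ⟨fun g => (isometry_smul ℍ g).continuous⟩

instance : MeasurableConstSMul PSL(2, ℝ) ℍ := ⟨fun g => (measurePreserving g).measurable⟩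

instance : SMulInvariantMeasure PSL(2, ℝ) ℍ volume :=
  ⟨fun g _ hs => (measurePreserving g).measure_preimage hs.nullMeasurableSet⟩

instance : MulAction.IsPretransitive PSL(2, ℝ) ℍ := ⟨fun x y => by
  obtain ⟨g, hg⟩ := MulAction.exists_smul_eq SL(2, ℝ) x y
  exact ⟨(g : PSL(2, ℝ)), hg⟩⟩

end PSLAction

/-! ### Mean value properties on hyperbolic circles and discs -/

namespace UpperHalfPlane

/-- The rotation about `I` with angle `t`. -/
def rotation (t : ℝ) : SL(2, ℝ) :=
  ⟨!![Real.cos (t / 2), Real.sin (t / 2); -Real.sin (t / 2), Real.cos (t / 2)], by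
    rw [Matrix.det_fin_two_of]
    nlinarith [Real.sin_sq_add_cos_sq (t / 2)]⟩

theorem continuous_rotation : Continuous rotation := by
  apply continuous_induced_rng.mpr
  refine continuous_matrix fun i j => ?_
  fin_cases i <;> fin_cases j <;> simp <;> fun_prop

/-- The Cayley transform of the upper half-plane centered at `m`. -/
def cayley (m z : ℍ) : ℂ := ((z : ℂ) - m) / (z - starRingEnd ℂ m)

theorem sub_conj_ne_zero (z m : ℍ) : (z : ℂ) - starRingEnd ℂ m ≠ 0 := by
  intro h
  have := congrArg Complex.im h
  simp at this
  linarith [z.im_pos, m.im_pos]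

theorem norm_cayley (m z : ℍ) : ‖cayley m z‖ = Real.tanh (dist z m / 2) := by
  rw [tanh_half_dist, cayley, norm_div, dist_eq_norm, dist_eq_norm]

theorem norm_cayley_lt_one (m z : ℍ) : ‖cayley m z‖ < 1 := by
  rw [norm_cayley]
  exact Real.tanh_lt_one _

theorem cayley_rotation_smul (t : ℝ) (z : ℍ) :
    cayley I (rotation t • z) = Complex.exp (t * Complex.I) * cayley I z := by
  have h1 := sub_conj_ne_zero z I
  have h2 := sub_conj_ne_zero (rotation t • z) I
  have h3 : Complex.exp (t * Complex.I) =
      (Complex.cos (t / 2) + Complex.sin (t / 2) * Complex.I) ^ 2 := by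
    rw [← Complex.exp_mul_I, ← Complex.exp_nat_mul]
    congr 1
    push_cast
    ring
  have h4 : -Complex.sin (t / 2) * (z : ℂ) + Complex.cos (t / 2) ≠ 0 := by
    have := denom_ne_zero (rotation t : GL (Fin 2) ℝ) z
    have h : denom (rotation t : GL (Fin 2) ℝ) z =
        ((-Real.sin (t / 2) : ℝ) : ℂ) * z + (Real.cos (t / 2) : ℝ) := rfl
    rw [h] at this
    push_cast at this
    exact this
  have h5 : (Complex.cos (t / 2)) ^ 2 + (Complex.sin (t / 2)) ^ 2 = 1 := by
    rw [add_comm]; exact Complex.sin_sq_add_cos_sq _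
  have h6 : ((rotation t • z : ℍ) : ℂ) = (Complex.cos (t / 2) * z + Complex.sin (t / 2)) /
      (-Complex.sin (t / 2) * z + Complex.cos (t / 2)) := by
    rw [coe_specialLinearGroup_apply]
    simp [rotation]
  unfold cayley
  rw [h3, ← mul_div_assoc, div_eq_div_iff h2 h1, h6]
  simp only [coe_I, Complex.conj_I, sub_neg_eq_add]
  generalize Complex.cos (t / 2) = c at *
  generalize Complex.sin (t / 2) = s at *
  rw [div_sub' h4, div_add' _ _ _ h4, div_mul_eq_mul_div, mul_div_assoc', div_left_inj' h4]
  have hA : c * z + s - (-s * z + c) * Complex.I = (c + s * Complex.I) * (z - Complex.I) := by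
    linear_combination s * Complex.I_sq
  have hB : c * z + s + Complex.I * (-s * z + c) = (c - s * Complex.I) * (z + Complex.I) := by
    linear_combination s * Complex.I_sq
  have hC : (c + s * Complex.I) * (c - s * Complex.I) = 1 := by
    linear_combination h5 - s ^ 2 * Complex.I_sq
  linear_combination (z + Complex.I) * hA -
    (c + s * Complex.I) ^ 2 * (z - Complex.I) * hB -
    (c + s * Complex.I) * (z - Complex.I) * (z + Complex.I) * hC

/-- The inverse of `cayley I` on the unit disc. -/
def cayleyInv (w : ℂ) : ℂ := Complex.I * (1 + w) / (1 - w)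

theorem cayleyInv_cayley (z : ℍ) : cayleyInv (cayley I z) = z := by
  have h1 := sub_conj_ne_zero z I
  have h2 : (1 : ℂ) - ((z : ℂ) - Complex.I) / (z + Complex.I) ≠ 0 := by
    simp only [coe_I, Complex.conj_I, sub_neg_eq_add] at h1
    intro h
    field_simp at h
    ring_nf at h
    simp at h
  simp only [coe_I, Complex.conj_I, sub_neg_eq_add, cayleyInv, cayley] at *
  rw [div_eq_iff h2]
  field_simp
  ring

theorem cayleyInv_im_pos {w : ℂ} (hw : ‖w‖ < 1) : 0 < (cayleyInv w).im := by
  have h0 : (1 : ℂ) - w ≠ 0 := by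
    intro h
    rw [← sub_eq_zero.mp h] at hw
    simp at hw
  have h1 : Complex.normSq w < 1 := by
    rw [Complex.normSq_eq_norm_sq]
    nlinarith [norm_nonneg w]
  have h2 := Complex.normSq_pos.mpr h0
  have : (cayleyInv w).im = (1 - Complex.normSq w) / Complex.normSq (1 - w) := by
    rw [cayleyInv, Complex.div_im]
    simp [Complex.normSq_apply]
    ring
  rw [this]
  exact div_pos (by linarith) h2

theorem differentiableAt_cayleyInv {w : ℂ} (hw : ‖w‖ < 1) : DifferentiableAt ℂ cayleyInv w := by
  have h0 : (1 : ℂ) - w ≠ 0 := by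
    intro h
    rw [← sub_eq_zero.mp h] at hw
    simp at hw
  unfold cayleyInv
  fun_prop (disch := assumption)

/-- The mean value property on hyperbolic circles. -/
theorem rotation_average {f : ℍ → ℂ} (hf : MDifferentiable 𝓘(ℂ) 𝓘(ℂ) f) (z : ℍ) :
    ∫ t in (0 : ℝ)..2 * Real.pi, f (rotation t • z) = (2 * Real.pi : ℝ) • f I := by
  -- In the Cayley coordinate at `I`, rotations about `I` multiply by unit complex numbers. So `F`
  -- runs through the rotation orbit of `z` on the unit circle, and the Euclidean mean value
  -- property applies with center value f(I).
  set F : ℂ → ℂ := fun w => f (ofComplex (cayleyInv (w * cayley I z)))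
  have key : Real.circleAverage F 0 1 = F 0 := by
    refine DiffContOnCl.circleAverage ?_
    refine DifferentiableOn.diffContOnCl ?_
    intro w hw
    have hw' : ‖w * cayley I z‖ < 1 := by
      rw [abs_one, closure_ball _ one_ne_zero, mem_closedBall_zero_iff] at hw
      rw [norm_mul]
      nlinarith [norm_cayley_lt_one I z, norm_nonneg (cayley I z), norm_nonneg w]
    have h1 := (mdifferentiableAt_iff.mp (hf ⟨_, cayleyInv_im_pos hw'⟩))
    refine DifferentiableAt.differentiableWithinAt ?_
    have h2 : DifferentiableAt ℂ (fun w => cayleyInv (w * cayley I z)) w :=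
      DifferentiableAt.comp (g := cayleyInv) w (differentiableAt_cayleyInv hw')
        (differentiableAt_id.mul_const _)
    exact DifferentiableAt.comp w (g := f ∘ ofComplex) h1 h2
  have h0 : F 0 = f I := by
    have : cayleyInv 0 = (I : ℍ) := by simp [cayleyInv]
    simp only [F, zero_mul, this, ofComplex_apply]
  have h1 : ∀ t, F (circleMap 0 1 t) = f (rotation t • z) := fun t => by
    have : circleMap 0 1 t * cayley I z = cayley I (rotation t • z) := by
      rw [cayley_rotation_smul]
      simp [circleMap]
    simp only [F, this, cayleyInv_cayley, ofComplex_apply]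
  rw [Real.circleAverage_def, h0] at key
  simp only [h1] at key
  rw [← key, smul_smul, mul_inv_cancel₀ (by positivity), one_smul]

theorem integrableOn_ball {E : Type*} [NormedAddCommGroup E] {f : ℍ → E} (hf : Continuous f)
    (z : ℍ) (R : ℝ) : IntegrableOn f (Metric.ball z R) :=
  (hf.continuousOn.integrableOn_compact (isCompact_closedBall z R)).mono_set
    Metric.ball_subset_closedBall

theorem measurePreserving_smul_restrict_ball (g : SL(2, ℝ)) (z : ℍ) (R : ℝ) :
    MeasurePreserving (fun w : ℍ => g • w) (volume.restrict (Metric.ball z R))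
      (volume.restrict (Metric.ball (g • z) R)) := by
  have h := (PSLAction.measurePreserving (g : PSL(2, ℝ))).restrict_preimage
    (Metric.isOpen_ball (x := g • z) (ε := R)).measurableSet
  have : (fun w : ℍ => (g : PSL(2, ℝ)) • w) ⁻¹' Metric.ball (g • z) R = Metric.ball z R := by
    ext w
    change dist (g • w) (g • z) < R ↔ _
    rw [dist_smul]
    rfl
  rw [this] at h
  exact h

theorem measurableEmbedding_smul (g : SL(2, ℝ)) : MeasurableEmbedding (fun w : ℍ => g • w) :=
  (Homeomorph.smul g).measurableEmbedding

theorem rotation_smul_I (t : ℝ) : rotation t • I = I := by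
  have h := cayley_rotation_smul t I
  have h0 : cayley I I = 0 := by simp [cayley]
  rw [h0, mul_zero] at h
  have h1 := norm_cayley I (rotation t • I)
  rw [h, norm_zero] at h1
  have h2 : dist (rotation t • I) I / 2 = 0 := by
    rw [← Real.tanh_zero] at h1
    exact (Real.tanh_injective h1).symm
  exact dist_eq_zero.mp (by linarith)

/-- Rotations about `I` preserve the disc and its area, so f may be replaced by its average over all
rotations, which is the constant f(I). -/
theorem integral_ball_I {f : ℍ → ℂ} (hf : MDifferentiable 𝓘(ℂ) 𝓘(ℂ) f) (R : ℝ) :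
    ∫ z in Metric.ball I R, f z = volume.real (Metric.ball (I : ℍ) R) • f I := by
  have hc := hf.continuous
  have h1 : ∀ t, ∫ z in Metric.ball I R, f (rotation t • z) = ∫ z in Metric.ball I R, f z := by
    intro t
    have := measurePreserving_smul_restrict_ball (rotation t) I R
    rw [rotation_smul_I] at this
    exact this.integral_comp (measurableEmbedding_smul _) f
  have h2 : ∫ t in (0 : ℝ)..2 * Real.pi, ∫ z in Metric.ball I R, f (rotation t • z) =
      ∫ z in Metric.ball I R, ∫ t in (0 : ℝ)..2 * Real.pi, f (rotation t • z) := by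
    refine intervalIntegral_integral_swap ?_
    have : Continuous (Function.uncurry fun (t : ℝ) (z : ℍ) => f (rotation t • z)) := by
      have := continuous_rotation
      simp only [Function.uncurry_def]
      fun_prop
    rw [Measure.prod_restrict]
    refine (this.continuousOn.integrableOn_compact
      ((isCompact_Icc (a := 0) (b := 2 * Real.pi)).prod
        (isCompact_closedBall (I : ℍ) R))).mono_set
      (Set.prod_mono ?_ Metric.ball_subset_closedBall)
    rw [Set.uIoc_of_le (by positivity)]
    exact Set.Ioc_subset_Icc_self
  simp only [h1, rotation_average hf] at h2
  rw [intervalIntegral.integral_const, sub_zero, setIntegral_const, smul_comm] at h2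
  exact smul_right_injective ℂ (by positivity : (2 * Real.pi : ℝ) ≠ 0) h2

/-- The mean value property on hyperbolic discs. -/
theorem integral_ball {f : ℍ → ℂ} (hf : MDifferentiable 𝓘(ℂ) 𝓘(ℂ) f) (z : ℍ) (R : ℝ) :
    ∫ w in Metric.ball z R, f w = volume.real (Metric.ball z R) • f z := by
  obtain ⟨g, rfl⟩ := MulAction.exists_smul_eq SL(2, ℝ) I z
  have h := measurePreserving_smul_restrict_ball g I R
  rw [← h.integral_comp (measurableEmbedding_smul _) f]
  have h1 : volume.real (Metric.ball (g • I) R) = volume.real (Metric.ball (I : ℍ) R) := by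
    have := h.measure_preimage MeasurableSet.univ.nullMeasurableSet
    simp only [Set.preimage_univ, Measure.restrict_apply_univ] at this
    rw [measureReal_def, measureReal_def, this]
  rw [h1, ← integral_ball_I (f := fun w => f (g • w))
    (hf.comp (PSLAction.mdifferentiable (g : PSL(2, ℝ))))]

/-- The sub-mean value property of the modulus of a holomorphic function. -/
theorem norm_mul_volume_ball_le {f : ℍ → ℂ} (hf : MDifferentiable 𝓘(ℂ) 𝓘(ℂ) f) (z : ℍ) (R : ℝ) :
    volume.real (Metric.ball z R) * ‖f z‖ ≤ ∫ w in Metric.ball z R, ‖f w‖ := by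
  have h := norm_integral_le_integral_norm (μ := volume.restrict (Metric.ball z R)) f
  rwa [integral_ball hf, norm_smul, Real.norm_of_nonneg measureReal_nonneg] at h

/-! ### A Liouville theorem for groups of finite covolume -/

instance : Measure.IsOpenPosMeasure (volume : Measure ℍ) where
  open_pos U hU hne h := by
    rw [volume_eq_lintegral, lintegral_eq_zero_iff (by fun_prop)] at h
    have hO : IsOpen (((↑) : ℍ → ℂ) '' U) := isOpenEmbedding_coe.isOpenMap U hU
    have h2 : ∀ᵐ z ∂(volume.restrict (((↑) : ℍ → ℂ) '' U)), False := by
      filter_upwards [h, ae_restrict_mem hO.measurableSet] with z hz hzU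
      obtain ⟨w, -, rfl⟩ := hzU
      have := w.im_pos.ne'
      simp [this] at hz
    rw [eventually_false_iff_eq_bot, ae_eq_bot, Measure.restrict_eq_zero] at h2
    exact hO.measure_ne_zero volume (hne.image _) h2

theorem volume_ball_eq (z : ℍ) (R : ℝ) :
    volume (Metric.ball z R) = volume (Metric.ball (I : ℍ) R) := by
  obtain ⟨g, rfl⟩ := MulAction.exists_smul_eq SL(2, ℝ) I z
  have h := measurePreserving_smul_restrict_ball g I R
  have := h.measure_preimage MeasurableSet.univ.nullMeasurableSet
  simpa using this.symm

/-- Exchanging the variables of an invariant kernel integrated over a fundamental domain. -/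
theorem _root_.MeasureTheory.IsFundamentalDomain.setLIntegral_lintegral_swap
    {G α : Type*} [Group G] [Countable G] [MulAction G α] [MeasurableSpace α]
    {μ : Measure α} [SFinite μ] [MeasurableConstSMul G α] [SMulInvariantMeasure G α μ]
    {F : Set α} (hF : IsFundamentalDomain G F μ) {K : α → α → ENNReal}
    (hK : Measurable (Function.uncurry K)) (hinv : ∀ (g : G) x y, K (g • x) (g • y) = K x y) :
    ∫⁻ x in F, ∫⁻ y, K x y ∂μ ∂μ = ∫⁻ y in F, ∫⁻ x, K x y ∂μ ∂μ := by
  have hK' : ∀ g : G, Measurable fun x : α × α => K (g⁻¹ • x.1) x.2 := fun g =>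
    hK.comp (by fun_prop : Measurable fun x : α × α => (g⁻¹ • x.1, x.2))
  have h3 : ∀ (g : G) x y, K x (g • y) = K (g⁻¹ • x) y := fun g x y => by
    rw [← hinv g (g⁻¹ • x) y, smul_inv_smul]
  -- Tile the domain of y by translates of F, move the group element to x by invariance, apply
  -- Tonelli, and reassemble the tiles in x.
  calc ∫⁻ x in F, ∫⁻ y, K x y ∂μ ∂μ
      = ∫⁻ x in F, ∑' g : G, ∫⁻ y in F, K (g⁻¹ • x) y ∂μ ∂μ := by
        refine lintegral_congr fun x => ?_
        rw [hF.lintegral_eq_tsum'']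
        simp only [h3]
    _ = ∑' g : G, ∫⁻ x in F, ∫⁻ y in F, K (g⁻¹ • x) y ∂μ ∂μ :=
        lintegral_tsum fun g => (hK' g).lintegral_prod_right'.aemeasurable
    _ = ∑' g : G, ∫⁻ y in F, ∫⁻ x in F, K (g⁻¹ • x) y ∂μ ∂μ :=
        tsum_congr fun g => lintegral_lintegral_swap (hK' g).aemeasurable
    _ = ∫⁻ y in F, ∑' g : G, ∫⁻ x in F, K (g⁻¹ • x) y ∂μ ∂μ :=
        (lintegral_tsum fun g => (hK' g).lintegral_prod_left'.aemeasurable).symm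
    _ = ∫⁻ y in F, ∫⁻ x, K x y ∂μ ∂μ := by
        refine lintegral_congr fun y => ?_
        rw [hF.lintegral_eq_tsum']

/-- The function `f w` cut off outside the hyperbolic disc around `z`. -/
def discKernel (f : ℍ → ENNReal) (R : ℝ) (z w : ℍ) : ENNReal :=
  {x : ℍ × ℍ | dist x.2 x.1 < R}.indicator (fun x => f x.2) (z, w)

theorem measurable_discKernel {f : ℍ → ENNReal} (hf : Measurable f) (R : ℝ) :
    Measurable (Function.uncurry (discKernel f R)) :=
  Measurable.indicator (by fun_prop) (isOpen_lt (by fun_prop) (by fun_prop)).measurableSet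

theorem lintegral_discKernel (f : ℍ → ENNReal) (R : ℝ) (z : ℍ) :
    ∫⁻ w, discKernel f R z w = ∫⁻ w in Metric.ball z R, f w := by
  rw [← lintegral_indicator Metric.isOpen_ball.measurableSet]
  rfl

theorem lintegral_discKernel_left (f : ℍ → ENNReal) (R : ℝ) (w : ℍ) :
    ∫⁻ z, discKernel f R z w = volume (Metric.ball (I : ℍ) R) * f w := by
  rw [← volume_ball_eq w, mul_comm, ← setLIntegral_const,
    ← lintegral_indicator Metric.isOpen_ball.measurableSet]
  refine lintegral_congr fun z => ?_
  simp only [discKernel, Set.indicator, Set.mem_ofPred_eq, Metric.mem_ball, dist_comm]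

/-- Averaging over hyperbolic discs preserves the integral over a fundamental domain. -/
theorem setLIntegral_ball_of_invariant {Γ : Subgroup PSL(2, ℝ)} [Countable Γ] {F : Set ℍ}
    (hF : IsFundamentalDomain Γ F) {f : ℍ → ENNReal} (hf : Measurable f)
    (hinv : ∀ γ ∈ Γ, ∀ z, f (γ • z) = f z) (R : ℝ) :
    ∫⁻ z in F, ∫⁻ w in Metric.ball z R, f w =
      volume (Metric.ball (I : ℍ) R) * ∫⁻ z in F, f z := by
  have h := hF.setLIntegral_lintegral_swap (measurable_discKernel hf R) (fun γ z w => by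
    have hd : dist (γ • w) (γ • z) = dist w z := dist_smul (γ : PSL(2, ℝ)) w z
    have hfw : f (γ • w) = f w := hinv γ γ.2 w
    simp only [discKernel, Set.indicator, Set.mem_ofPred_eq, hd, hfw])
  simp only [lintegral_discKernel, lintegral_discKernel_left] at h
  rw [h, lintegral_const_mul _ hf]

theorem volume_ball_ne_top (z : ℍ) (R : ℝ) : volume (Metric.ball z R) ≠ ⊤ :=
  ((measure_mono Metric.ball_subset_closedBall).trans_lt
    (isCompact_closedBall z R).measure_lt_top).ne

theorem integral_ball_sub_sq {u : ℍ → ℝ} (hu : Continuous u) (z : ℍ) (R c : ℝ) :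
    ∫ w in Metric.ball z R, (u w - c) ^ 2 = (∫ w in Metric.ball z R, u w ^ 2)
      - 2 * c * (∫ w in Metric.ball z R, u w) + c ^ 2 * volume.real (Metric.ball z R) := by
  have h1 : IntegrableOn (fun w => u w ^ 2) (Metric.ball z R) := integrableOn_ball (hu.pow 2) z R
  have h2 : IntegrableOn (fun w => 2 * c * u w) (Metric.ball z R) :=
    integrableOn_ball (by fun_prop) z R
  have h3 : IntegrableOn (fun _ : ℍ => c ^ 2) (Metric.ball z R) :=
    integrableOn_ball (by fun_prop) z R
  have : ∀ w, (u w - c) ^ 2 = u w ^ 2 - 2 * c * u w + c ^ 2 := fun w => by ring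
  simp only [this]
  have h4 : IntegrableOn (fun w => u w ^ 2 - 2 * c * u w) (Metric.ball z R) := h1.sub h2
  rw [integral_add h4 h3, integral_sub h1 h2, integral_const_mul, setIntegral_const,
    smul_eq_mul, mul_comm (volume.real _)]

/-- A bounded nonnegative continuous function with the sub-mean value property on hyperbolic discs
that is invariant under a group of finite covolume is constant. -/
theorem eq_of_subMean_of_invariant {Γ : Subgroup PSL(2, ℝ)} [Countable Γ] {F : Set ℍ}
    (hF : IsFundamentalDomain Γ F) (hvol : volume F < ⊤) {u : ℍ → ℝ} (hu : Continuous u)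
    (h0 : ∀ z, 0 ≤ u z) (hle : ∀ z, u z ≤ 1) (hinv : ∀ γ ∈ Γ, ∀ z, u (γ • z) = u z)
    (hsub : ∀ z R, volume.real (Metric.ball z R) * u z ≤ ∫ w in Metric.ball z R, u w)
    (z w : ℍ) : u z = u w := by
  -- Squaring makes the inequality strict: equality of u² with its mean over a disc forces u to be
  -- constant there.
  set f : ℍ → ENNReal := fun z => ENNReal.ofReal (u z ^ 2) with hf
  have hfm : Measurable f := (hu.pow 2).measurable.ennreal_ofReal
  have hint : ∀ z R, ∫⁻ w in Metric.ball z R, f w =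
      ENNReal.ofReal (∫ w in Metric.ball z R, u w ^ 2) := fun z R =>
    (ofReal_integral_eq_lintegral_ofReal (integrableOn_ball (hu.pow 2) z R)
      (ae_of_all _ fun w => sq_nonneg _)).symm
  have hV : ∀ z R, volume (Metric.ball (I : ℍ) R) * f z =
      ENNReal.ofReal (volume.real (Metric.ball z R) * u z ^ 2) := fun z R => by
    rw [ENNReal.ofReal_mul measureReal_nonneg, ofReal_measureReal (volume_ball_ne_top z R),
      volume_ball_eq z]
  have hle1 : ∀ z R, volume (Metric.ball (I : ℍ) R) * f z ≤ ∫⁻ w in Metric.ball z R, f w := by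
    intro z R
    rw [hint, hV]
    refine ENNReal.ofReal_le_ofReal ?_
    -- Expanding ∫ (u - u z)² ≥ 0 and inserting the sub-mean value property of u gives that of u².
    have h1 := integral_ball_sub_sq hu z R (u z)
    have h2 : 0 ≤ ∫ w in Metric.ball z R, (u w - u z) ^ 2 :=
      integral_nonneg fun w => sq_nonneg _
    nlinarith [hsub z R, h0 z]
  have hfin : ∫⁻ z in F, f z ≠ ⊤ := by
    have : ∫⁻ z in F, f z ≤ ∫⁻ z in F, 1 := setLIntegral_mono measurable_const fun z _ => by
      exact ENNReal.ofReal_le_one.mpr (pow_le_one₀ (h0 z) (hle z))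
    rw [setLIntegral_one] at this
    exact (this.trans_lt hvol).ne
  -- Both sides have the same finite integral over F, so the inequality `hle1` is almost everywhere
  -- an equality. Integer radii keep the exceptional set null, so one point `a` serves for
  -- arbitrarily large discs.
  have hae : ∀ᵐ z ∂(volume.restrict F), ∀ n : ℕ,
      volume (Metric.ball (I : ℍ) n) * f z = ∫⁻ w in Metric.ball z n, f w := by
    rw [ae_all_iff]
    intro n
    have hfun := setLIntegral_ball_of_invariant hF hfm
      (fun γ hγ z => by simp only [hf, hinv γ hγ z]) (n : ℝ)
    refine ae_eq_of_ae_le_of_lintegral_le (ae_of_all _ fun z => hle1 z n) ?_ ?_ ?_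
    · rw [lintegral_const_mul _ hfm]
      exact ENNReal.mul_ne_top (volume_ball_ne_top _ _) hfin
    · simp only [← lintegral_discKernel]
      exact (measurable_discKernel hfm n).lintegral_prod_right'.aemeasurable
    · rw [hfun, lintegral_const_mul _ hfm]
  have hne : NeBot (ae (volume.restrict F)) := by
    rw [ae_neBot, Ne, Measure.restrict_eq_zero]
    exact hF.measure_ne_zero (NeZero.ne volume)
  obtain ⟨a, ha⟩ := hae.exists
  have key : ∀ z, u z = u a := by
    intro z
    obtain ⟨n, hn⟩ := exists_nat_gt (dist z a)
    have h1 := ha n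
    rw [hint, hV, ENNReal.ofReal_eq_ofReal_iff
      (mul_nonneg measureReal_nonneg (sq_nonneg _)) (integral_nonneg fun w => sq_nonneg _)] at h1
    have h2 := integral_ball_sub_sq hu a n (u a)
    have h3 : ∫ w in Metric.ball a n, (u w - u a) ^ 2 = 0 := by
      refine le_antisymm ?_ (integral_nonneg fun w => sq_nonneg _)
      nlinarith [hsub a n, h0 a]
    have h4 := (setIntegral_eq_zero_iff_of_nonneg_ae (ae_of_all _ fun w => sq_nonneg _)
      (integrableOn_ball (by fun_prop) a n)).mp h3
    have h5 := Measure.eqOn_open_of_ae_eq h4 Metric.isOpen_ball (by fun_prop) (by fun_prop)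
    have h6 : (u z - u a) ^ 2 = 0 := h5 hn
    nlinarith [pow_eq_zero_iff (two_ne_zero) |>.mp h6]
  rw [key z, key w]

/-! ### Rigidity of holomorphic maps at invariant distance -/

/-- In the disc model centered at `m` this is, up to a unit, half the difference of `x` and `y`. -/
def halfDiff (m x y : ℍ) : ℂ :=
  m.im * ((x : ℂ) - y) / (((x : ℂ) - starRingEnd ℂ m) * ((y : ℂ) - starRingEnd ℂ m))

theorem norm_halfDiff (m x y : ℍ) : ‖halfDiff m x y‖ =
    Real.sinh (dist x y / 2) / (2 * Real.cosh (dist x m / 2) * Real.cosh (dist y m / 2)) := by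
  have hx := x.im_pos
  have hy := y.im_pos
  have hm := m.im_pos
  have h1 := norm_ne_zero_iff.mpr (sub_conj_ne_zero x m)
  have h2 := norm_ne_zero_iff.mpr (sub_conj_ne_zero y m)
  rw [sinh_half_dist, cosh_half_dist, cosh_half_dist, halfDiff, norm_div, norm_mul, norm_mul,
    Complex.norm_real, Real.norm_of_nonneg hm.le, dist_eq_norm, dist_eq_norm, dist_eq_norm,
    Real.sqrt_mul hx.le, Real.sqrt_mul hx.le, Real.sqrt_mul hy.le]
  have h3 := (Real.sqrt_pos.mpr hx).ne'
  have h4 := (Real.sqrt_pos.mpr hy).ne'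
  have h5 := (Real.sqrt_pos.mpr hm).ne'
  have h6 := Real.sq_sqrt hm.le
  field_simp
  rw [h6]
  ring

theorem _root_.Real.tanh_half_eq (x : ℝ) :
    Real.tanh (x / 2) = Real.sinh x / (Real.cosh x + 1) := by
  have h1 : x = 2 * (x / 2) := by ring
  have h2 := Real.cosh_pos (x / 2)
  have h3 := Real.cosh_sq (x / 2)
  have h4 : Real.cosh x + 1 = 2 * Real.cosh (x / 2) ^ 2 := by
    conv_lhs => rw [h1, Real.cosh_two_mul]
    linarith
  have h5 : Real.sinh x = 2 * Real.sinh (x / 2) * Real.cosh (x / 2) := by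
    conv_lhs => rw [h1, Real.sinh_two_mul]
  rw [h4, h5, Real.tanh_eq_sinh_div_cosh]
  field_simp

theorem _root_.Real.two_mul_cosh_mul_cosh (x y : ℝ) :
    2 * Real.cosh x * Real.cosh y = Real.cosh (x + y) + Real.cosh (x - y) := by
  rw [Real.cosh_add, Real.cosh_sub]
  ring

theorem cosh_half_dist_add_one_le (m x y : ℍ) : Real.cosh (dist x y / 2) + 1 ≤
    2 * Real.cosh (dist x m / 2) * Real.cosh (dist y m / 2) := by
  rw [Real.two_mul_cosh_mul_cosh]
  refine add_le_add ?_ (Real.one_le_cosh _)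
  rw [Real.cosh_le_cosh, abs_of_nonneg (by positivity), abs_of_nonneg (by positivity)]
  linarith [dist_triangle_right x y m]

/-- The product formula for cosh and the triangle inequality bound the denominator below, with
equality exactly at the midpoint. Thus tanh(dist/4) is a maximum over m of moduli of functions
holomorphic in x and y, which makes it subharmonic along pairs of holomorphic maps. -/
theorem norm_halfDiff_le (m x y : ℍ) : ‖halfDiff m x y‖ ≤ Real.tanh (dist x y / 4) := by
  rw [norm_halfDiff, show dist x y / 4 = dist x y / 2 / 2 by ring, Real.tanh_half_eq]
  refine div_le_div_of_nonneg_left (Real.sinh_nonneg_iff.mpr (by positivity))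
    (by linarith [Real.cosh_pos (dist x y / 2)]) (cosh_half_dist_add_one_le m x y)

/-- Equality holds in `norm_halfDiff_le` only if `m` is the midpoint of `x` and `y`. -/
theorem dist_eq_of_norm_halfDiff_eq {m x y : ℍ} (hxy : x ≠ y)
    (h : ‖halfDiff m x y‖ = Real.tanh (dist x y / 4)) : dist x m = dist x y / 2 := by
  have hd : 0 < dist x y := dist_pos.mpr hxy
  have hs : 0 < Real.sinh (dist x y / 2) := Real.sinh_pos_iff.mpr (by positivity)
  rw [norm_halfDiff, show dist x y / 4 = dist x y / 2 / 2 by ring, Real.tanh_half_eq,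
    div_eq_div_iff (mul_pos (mul_pos two_pos (Real.cosh_pos _)) (Real.cosh_pos _)).ne'
      (by linarith [Real.cosh_pos (dist x y / 2)]), mul_right_inj' hs.ne', Real.two_mul_cosh_mul_cosh] at h
  have h1 : Real.cosh (dist x y / 2) ≤ Real.cosh (dist x m / 2 + dist y m / 2) := by
    rw [Real.cosh_le_cosh, abs_of_nonneg (by positivity), abs_of_nonneg (by positivity)]
    linarith [dist_triangle_right x y m]
  have h2 := Real.one_le_cosh (dist x m / 2 - dist y m / 2)
  have h3 : Real.cosh (dist x m / 2 - dist y m / 2) ≤ Real.cosh 0 := by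
    rw [Real.cosh_zero]
    linarith
  have h4 : Real.cosh (dist x m / 2 + dist y m / 2) ≤ Real.cosh (dist x y / 2) := by linarith
  rw [Real.cosh_le_cosh, abs_zero, abs_nonpos_iff] at h3
  rw [Real.cosh_le_cosh, abs_of_nonneg (by positivity), abs_of_nonneg (by positivity)] at h4
  linarith [dist_triangle_right x y m]

theorem exists_midpoint (x y : ℍ) : ∃ m : ℍ, dist x m = dist x y / 2 ∧ dist y m = dist x y / 2 := by
  have hx := x.im_pos
  have hy := y.im_pos
  set T := √((x.re - y.re) ^ 2 + (x.im + y.im) ^ 2) with hT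
  have hT0 : 0 < T := Real.sqrt_pos.mpr (by positivity)
  have hT2 : T ^ 2 = (x.re - y.re) ^ 2 + (x.im + y.im) ^ 2 := Real.sq_sqrt (by positivity)
  set P := √(x.im * y.im) with hP
  have hP0 : 0 < P := Real.sqrt_pos.mpr (by positivity)
  have hP2 : P ^ 2 = x.im * y.im := Real.sq_sqrt (by positivity)
  have hD : Real.cosh (dist x y / 2) = T / (2 * P) := by
    rw [cosh_half_dist, Complex.dist_eq_re_im]
    simp [hT, hP]
  -- The real part is where the Euclidean segment from x to the conjugate of y crosses the real
  -- axis; `T` is the length of that segment.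
  let m : ℍ := ⟨⟨(x.re * y.im + y.re * x.im) / (x.im + y.im), P * T / (x.im + y.im)⟩,
    by positivity⟩
  have hmre : m.re = (x.re * y.im + y.re * x.im) / (x.im + y.im) := rfl
  have hmim : m.im = P * T / (x.im + y.im) := rfl
  have hinj : ∀ a b : ℝ, 0 ≤ a → 0 ≤ b → Real.cosh a = Real.cosh b → a = b := fun a b ha hb h =>
    Real.cosh_strictMonoOn.injOn ha hb h
  refine ⟨m, hinj _ _ (by positivity) (by positivity) ?_,
    hinj _ _ (by positivity) (by positivity) ?_⟩
  · rw [hD, cosh_dist', hmre, hmim]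
    field_simp
    rw [hT2, hP2]
    ring
  · rw [hD, cosh_dist', hmre, hmim]
    field_simp
    rw [hT2, hP2]
    ring

theorem exists_norm_halfDiff_eq (x y : ℍ) :
    ∃ m : ℍ, ‖halfDiff m x y‖ = Real.tanh (dist x y / 4) := by
  obtain ⟨m, h1, h2⟩ := exists_midpoint x y
  refine ⟨m, ?_⟩
  rw [norm_halfDiff, show dist x y / 4 = dist x y / 2 / 2 by ring, Real.tanh_half_eq,
    Real.two_mul_cosh_mul_cosh, h1, h2]
  simp

theorem cayley_injective (m : ℍ) : Function.Injective (cayley m) := by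
  intro x y h
  rw [cayley, cayley, div_eq_div_iff (sub_conj_ne_zero x m) (sub_conj_ne_zero y m)] at h
  have h1 : ((x : ℂ) - y) * ((m : ℂ) - starRingEnd ℂ m) = 0 := by linear_combination h
  rcases mul_eq_zero.mp h1 with h2 | h2
  · exact UpperHalfPlane.ext (sub_eq_zero.mp h2)
  · exact absurd h2 (sub_conj_ne_zero m m)

theorem mdifferentiable_halfDiff (m : ℍ) {p q : ℍ → ℍ} (hp : MDifferentiable 𝓘(ℂ) 𝓘(ℂ) p)
    (hq : MDifferentiable 𝓘(ℂ) 𝓘(ℂ) q) :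
    MDifferentiable 𝓘(ℂ) 𝓘(ℂ) (fun z => halfDiff m (p z) (q z)) := by
  have hp' := mdifferentiable_iff.mp (mdifferentiable_coe.comp hp)
  have hq' := mdifferentiable_iff.mp (mdifferentiable_coe.comp hq)
  rw [mdifferentiable_iff]
  exact ((hp'.sub hq').const_mul _).fun_div ((hp'.sub_const _).mul (hq'.sub_const _)) fun z _ =>
    mul_ne_zero (sub_conj_ne_zero _ _) (sub_conj_ne_zero _ _)

theorem mdifferentiable_cayley (m : ℍ) {p : ℍ → ℍ} (hp : MDifferentiable 𝓘(ℂ) 𝓘(ℂ) p) :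
    MDifferentiable 𝓘(ℂ) 𝓘(ℂ) (fun z => cayley m (p z)) := by
  have hp' := mdifferentiable_iff.mp (mdifferentiable_coe.comp hp)
  rw [mdifferentiable_iff]
  exact (hp'.sub_const _).fun_div (hp'.sub_const _) fun z _ => sub_conj_ne_zero _ _

/-- Two holomorphic maps whose distance is invariant under a group of finite covolume coincide,
unless they are constant. -/
theorem eq_of_dist_invariant {Γ : Subgroup PSL(2, ℝ)} [Countable Γ] {F : Set ℍ}
    (hF : IsFundamentalDomain Γ F) (hvol : volume F < ⊤) {p q : ℍ → ℍ}
    (hp : MDifferentiable 𝓘(ℂ) 𝓘(ℂ) p) (hq : MDifferentiable 𝓘(ℂ) 𝓘(ℂ) q)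
    (hinv : ∀ γ ∈ Γ, ∀ z, dist (p (γ • z)) (q (γ • z)) = dist (p z) (q z))
    (hne : ¬ ∃ w, ∀ z, p z = w) : p = q := by
  have hpc := hp.continuous
  have hqc := hq.continuous
  have hu : Continuous fun z => Real.tanh (dist (p z) (q z) / 4) := by
    simp only [Real.tanh_eq_sinh_div_cosh]
    have := Real.continuous_sinh
    have := Real.continuous_cosh
    refine Continuous.div (by fun_prop) (by fun_prop) fun z => (Real.cosh_pos _).ne'
  have hconst := eq_of_subMean_of_invariant hF hvol hu
    (fun z => by
      rw [Real.tanh_eq_sinh_div_cosh]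
      exact div_nonneg (Real.sinh_nonneg_iff.mpr (by positivity)) (Real.cosh_pos _).le)
    (fun z => (Real.tanh_lt_one _).le) (fun γ hγ z => by simp only [hinv γ hγ z])
    (fun z R => by
      -- For the midpoint m of p z and q z, the modulus of a holomorphic function lies below u
      -- everywhere and touches it at z.
      obtain ⟨m, hm⟩ := exists_norm_halfDiff_eq (p z) (q z)
      have hd := mdifferentiable_halfDiff m hp hq
      have h := norm_mul_volume_ball_le hd z R
      simp only [hm] at h
      refine h.trans (integral_mono (integrableOn_ball hd.continuous.norm z R)
        (integrableOn_ball hu z R) fun w => norm_halfDiff_le _ _ _))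
  by_contra hpq
  obtain ⟨a, ha⟩ := Function.ne_iff.mp hpq
  have hdist : ∀ z, dist (p z) (q z) = dist (p a) (q a) := fun z => by
    have := Real.tanh_injective (hconst z a)
    linarith
  obtain ⟨m, hm⟩ := exists_norm_halfDiff_eq (p a) (q a)
  have hmax := (mdifferentiable_halfDiff m hp hq).mdifferentiableOn (s := Set.univ)
    |>.norm_eqOn_of_isPreconnected_of_isMaxOn isPreconnected_univ isOpen_univ (Set.mem_univ a)
    (fun z _ => by
      simp only [Function.comp, Set.mem_ofPred_eq, hm]
      exact (norm_halfDiff_le _ _ _).trans (hconst z a).le)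
  -- The modulus of `halfDiff m` is constant by the maximum principle, so the bound is attained
  -- everywhere and m is the midpoint for every z. Then p stays on a circle about m, and a second
  -- maximum principle makes p constant.
  have hmid : ∀ z, dist (p z) m = dist (p a) (q a) / 2 := fun z => by
    have h1 : ‖halfDiff m (p z) (q z)‖ = Real.tanh (dist (p z) (q z) / 4) := by
      rw [hdist, ← hm]
      exact hmax (Set.mem_univ z)
    have hz : p z ≠ q z := dist_pos.mp (hdist z ▸ dist_pos.mpr ha)
    rw [dist_eq_of_norm_halfDiff_eq hz h1, hdist]
  refine hne ⟨p a, fun z => cayley_injective m ?_⟩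
  refine (mdifferentiable_cayley m hp).mdifferentiableOn (s := Set.univ)
    |>.eqOn_of_isPreconnected_of_isMaxOn_norm isPreconnected_univ isOpen_univ (Set.mem_univ a)
    (fun z _ => ?_) (Set.mem_univ z)
  simp only [Function.comp, Set.mem_ofPred_eq, norm_cayley, hmid, le_refl]

end UpperHalfPlane

/-! ### Finite-index subgroups, countability and fixed points -/

/-- A subgroup of finite index has a fundamental domain of finite measure if the group does. -/
theorem MeasureTheory.IsFundamentalDomain.exists_of_relIndex_ne_zero {G α : Type*} [Group G]
    [MulAction G α] [MeasurableSpace α] {μ : Measure α} [MeasurableConstSMul G α]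
    [SMulInvariantMeasure G α μ] {Γ Γ' : Subgroup G} (hle : Γ' ≤ Γ) (hind : Γ'.relIndex Γ ≠ 0)
    {F : Set α} (hF : IsFundamentalDomain Γ F μ) (hfin : μ F < ⊤) :
    ∃ F' : Set α, IsFundamentalDomain Γ' F' μ ∧ μ F' < ⊤ := by
  have : (Γ'.subgroupOf Γ).FiniteIndex := ⟨hind⟩
  -- Inverses of left coset representatives represent the right cosets Γ'r, so the translates r F
  -- together tile modulo Γ'.
  set r : Γ ⧸ Γ'.subgroupOf Γ → Γ := fun q => (q.out)⁻¹ with hr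
  refine ⟨⋃ q, r q • F, IsFundamentalDomain.mk'' ?_ ?_ ?_ ?_, ?_⟩
  · exact NullMeasurableSet.iUnion fun q => hF.nullMeasurableSet_smul _
  · filter_upwards [hF.ae_covers] with x ⟨γ, hγ⟩
    have h1 := QuotientGroup.mk_out_eq_mul (Γ'.subgroupOf Γ) γ
    obtain ⟨δ, hδ⟩ := h1
    have h2 : ((δ : Γ) : G) ∈ Γ' := Subgroup.mem_subgroupOf.mp δ.2
    refine ⟨⟨((δ : Γ) : G), h2⟩⁻¹, Set.mem_iUnion.mpr ⟨(γ : Γ ⧸ Γ'.subgroupOf Γ), ?_⟩⟩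
    rw [Set.mem_smul_set_iff_inv_smul_mem]
    convert hγ using 1
    simp only [hr, hδ, inv_inv]
    change ((γ : G) * ((δ : Γ) : G)) • (((δ : Γ) : G))⁻¹ • x = (γ : G) • x
    rw [smul_smul, mul_inv_cancel_right]
  · intro g hg
    rw [Set.smul_set_iUnion, AEDisjoint.iUnion_left_iff]
    intro q
    rw [AEDisjoint.iUnion_right_iff]
    intro q'
    have h1 : g • r q • F = ((⟨g, hle g.2⟩ : Γ) * r q) • F := by
      rw [← smul_smul]
      rfl
    rw [h1]
    refine hF.aedisjoint ?_
    intro h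
    have h2 : (q.out : Γ) = q'.out * ⟨g, hle g.2⟩ := by
      have := congrArg (fun x => q'.out * x * q.out) h
      simpa [hr, mul_assoc] using this.symm
    have h3 : q = q' := by
      rw [← q.out_eq', ← q'.out_eq', h2]
      exact QuotientGroup.mk_mul_of_mem _ (Subgroup.mem_subgroupOf.mpr g.2)
    rw [h3, left_eq_mul] at h2
    exact hg (Subtype.ext (congrArg (fun x : Γ => (x : G)) h2))
  · intro g
    exact (measurePreserving_smul (g : G) μ).quasiMeasurePreserving
  · refine (measure_iUnion_le _).trans_lt ?_
    have h1 : ∀ q, μ (r q • F) = μ F := fun q => MeasureTheory.measure_smul μ (r q) F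
    simp only [h1]
    have := Fintype.ofFinite (Γ ⧸ Γ'.subgroupOf Γ)
    rw [tsum_fintype]
    exact ENNReal.sum_lt_top.mpr fun _ _ => hfin

theorem IsFuchsianLattice.countable {Γ : Subgroup PSL(2, ℝ)} (hΓ : IsFuchsianLattice Γ) :
    Countable Γ := by
  have := hΓ.discrete
  have : SecondCountableTopology (Matrix (Fin 2) (Fin 2) ℝ) :=
    inferInstanceAs (SecondCountableTopology (Fin 2 → Fin 2 → ℝ))
  have : SecondCountableTopology SL(2, ℝ) :=
    (Matrix.SpecialLinearGroup.isClosedEmbedding_val).isEmbedding.secondCountableTopology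
  have : SecondCountableTopology PSL(2, ℝ) :=
    inferInstanceAs (SecondCountableTopology (SL(2, ℝ) ⧸ Subgroup.center SL(2, ℝ)))
  exact countable_of_Lindelof_of_discrete

namespace PSLAction

open UpperHalfPlane in
-- A noncentral element with a fixed point in ℍ is elliptic, and then its fixed point is unique.
theorem mem_center_of_smul_eq {g : SL(2, ℝ)} {x y : ℍ} (hxy : x ≠ y) (hx : g • x = x)
    (hy : g • y = y) : g ∈ Subgroup.center SL(2, ℝ) := by
  have hdet : 0 < (g : GL (Fin 2) ℝ).val.det := by simp
  by_cases hc : (g : GL (Fin 2) ℝ) ∈ Subgroup.center (GL (Fin 2) ℝ)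
  · rw [Subgroup.mem_center_iff] at hc ⊢
    intro h
    apply Matrix.SpecialLinearGroup.toGL_injective
    rw [map_mul, map_mul]
    exact hc _
  · have hell := isElliptic_of_exists_smul_eq_self hdet hc ⟨x, hx⟩
    exact absurd (((gl_smul_eq_self_iff_eq_fixedPt hdet hell).mp hx).trans
      ((gl_smul_eq_self_iff_eq_fixedPt hdet hell).mp hy).symm) hxy

theorem eq_one_of_smul_eq {g : PSL(2, ℝ)} {x y : ℍ} (hxy : x ≠ y) (hx : g • x = x)
    (hy : g • y = y) : g = 1 := by
  obtain ⟨g, rfl⟩ := QuotientGroup.mk_surjective g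
  exact (QuotientGroup.eq_one_iff g).mpr (mem_center_of_smul_eq hxy hx hy)

end PSLAction

/-! ### The commensurator as a group of symmetries of p -/

namespace ModularEmbedding

variable {E : ModularEmbedding}

/-- On Γ' both p and g ∘ p ∘ h⁻¹ are equivariant for the same isometric action on the target, so
their distance is Γ'-invariant and rigidity applies. -/
theorem p_smul_of_mem_comm (hp : ¬ ∃ w, ∀ z, E.p z = w) {x : PSL(2, ℝ) × PSL(2, ℝ)}
    (hx : x ∈ E.comm) (z : ℍ) : E.p (x.2 • z) = x.1 • E.p z := by
  obtain ⟨Γ', h₁, h₂, ⟨i₁⟩, -, hr⟩ := hx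
  obtain ⟨-, F, hF, hvol⟩ := E.isLattice
  have := E.isLattice.countable
  obtain ⟨F', hF', hvol'⟩ := hF.exists_of_relIndex_ne_zero h₁ i₁ hvol
  have : Countable Γ' := (Subgroup.inclusion_injective h₁).countable
  have h := UpperHalfPlane.eq_of_dist_invariant hF' hvol' E.holomorphic
    (act x.1 x.2 E).holomorphic (fun γ hγ w => by
      have e₁ := E.equivariant ⟨γ, h₁ hγ⟩ w
      have e₂ := (act x.1 x.2 E).equivariant ⟨γ, h₂ hγ⟩ w
      rw [← hr γ hγ] at e₂
      rw [e₁, e₂, dist_smul]) hp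
  have h3 := congrFun h (x.2 • z)
  change E.p (x.2 • z) = x.1 • E.p (x.2⁻¹ • x.2 • z) at h3
  rwa [inv_smul_smul] at h3

/-- A non-constant p takes two distinct values, and both are fixed by g'⁻¹g. -/
theorem eq_of_forall_smul_eq (hp : ¬ ∃ w, ∀ z, E.p z = w) {g g' : PSL(2, ℝ)}
    (h : ∀ z, g • E.p z = g' • E.p z) : g = g' := by
  push Not at hp
  obtain ⟨z, hz⟩ := hp (E.p UpperHalfPlane.I)
  have h1 : ∀ z, (g'⁻¹ * g) • E.p z = E.p z := fun z => by
    rw [mul_smul, h, inv_smul_smul]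
  exact (inv_mul_eq_one.mp (PSLAction.eq_one_of_smul_eq hz (h1 _) (h1 _))).symm

theorem domEmb_range_le_comm (E : ModularEmbedding) : E.domEmb.range ≤ E.comm := by
  rintro _ ⟨γ, rfl⟩
  have hconj : ∀ x, x ∈ MulAut.conj (γ : PSL(2, ℝ)) • E.dom ↔ x ∈ E.dom := fun x => by
    rw [mem_conj_smul, E.dom.mul_mem_cancel_right γ.2, E.dom.mul_mem_cancel_left (inv_mem γ.2)]
  have heq : MulAut.conj (γ : PSL(2, ℝ)) • E.dom = E.dom := Subgroup.ext hconj
  refine ⟨E.dom, le_rfl, heq.ge, ⟨by simp⟩, ⟨?_⟩, fun x hx => ?_⟩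
  · change E.dom.relIndex (MulAut.conj (γ : PSL(2, ℝ)) • E.dom) ≠ 0
    rw [heq]
    simp
  · change E.rho ⟨x, hx⟩ = E.rho γ * E.rho ⟨(γ : PSL(2, ℝ))⁻¹ * x * γ, _⟩ * (E.rho γ)⁻¹
    rw [← map_inv, ← map_mul, ← map_mul]
    congr 1
    exact Subtype.ext (by simp [mul_assoc])

theorem snd_injective_of_mem_comm (hp : ¬ ∃ w, ∀ z, E.p z = w) :
    Function.Injective fun x : E.comm => (x : PSL(2, ℝ) × PSL(2, ℝ)).2 := by
  rintro ⟨⟨g, h⟩, hx⟩ ⟨⟨g', h'⟩, hy⟩ (rfl : h = h')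
  have := eq_of_forall_smul_eq hp (g := g) (g' := g') fun z => by
    rw [← p_smul_of_mem_comm hp hx z, ← p_smul_of_mem_comm hp hy z]
  subst this
  rfl

/-- Since h determines g, an element (g, h) of the commensurator with h ∈ Γ must be (ρ(h), h). This
lets the index be computed in the second factor. -/
theorem domEmb_range_subgroupOf_comm (hp : ¬ ∃ w, ∀ z, E.p z = w) :
    E.domEmb.range.subgroupOf E.comm =
      E.dom.comap ((MonoidHom.snd PSL(2, ℝ) PSL(2, ℝ)).comp E.comm.subtype) := by
  ext x
  simp only [Subgroup.mem_subgroupOf, Subgroup.mem_comap, MonoidHom.mem_range]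
  constructor
  · rintro ⟨γ, hγ⟩
    have : (x : PSL(2, ℝ) × PSL(2, ℝ)).2 = γ := by rw [← hγ]; rfl
    change (x : PSL(2, ℝ) × PSL(2, ℝ)).2 ∈ E.dom
    rw [this]
    exact γ.2
  · intro hx
    refine ⟨⟨_, hx⟩, ?_⟩
    exact congrArg Subtype.val (snd_injective_of_mem_comm hp
      (a₁ := ⟨_, domEmb_range_le_comm E ⟨⟨_, hx⟩, rfl⟩⟩) (a₂ := x) rfl)

end ModularEmbedding

/-! ### Centralizers of 2 × 2 matrices -/

theorem Matrix.exists_eq_smul_one_add_smul_of_commute {A B : Matrix (Fin 2) (Fin 2) ℝ}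
    (hA : ∀ c : ℝ, A ≠ c • 1) (h : A * B = B * A) : ∃ α β : ℝ, B = α • 1 + β • A := by
  have e00 := congrFun (congrFun h 0) 0
  have e01 := congrFun (congrFun h 0) 1
  have e10 := congrFun (congrFun h 1) 0
  simp only [Matrix.mul_apply, Fin.sum_univ_two] at e00 e01 e10
  -- Commutation says that the vectors of (0,1) entry, (1,0) entry and diagonal difference of A and
  -- B are parallel. The factor β is read off a nonzero component for A.
  have key : ∀ β : ℝ, B 0 1 = β * A 0 1 → B 1 0 = β * A 1 0 →
      B 0 0 - B 1 1 = β * (A 0 0 - A 1 1) → ∃ α β : ℝ, B = α • 1 + β • A := by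
    intro β h1 h2 h3
    refine ⟨B 0 0 - β * A 0 0, β, ?_⟩
    ext i j
    fin_cases i <;> fin_cases j <;> simp [h1, h2]
    linarith
  by_cases h01 : A 0 1 = 0
  · by_cases h10 : A 1 0 = 0
    · have h11 : A 0 0 - A 1 1 ≠ 0 := fun h' => hA (A 0 0) (by
        ext i j
        fin_cases i <;> fin_cases j <;> simp [h01, h10]
        linarith)
      refine key ((B 0 0 - B 1 1) / (A 0 0 - A 1 1)) ?_ ?_ (by field_simp)
      · rw [h01] at e01 ⊢
        exact (mul_eq_zero.mp (by linarith : (A 0 0 - A 1 1) * B 0 1 = 0)).resolve_left h11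
          |>.trans (by ring)
      · rw [h10] at e10 ⊢
        exact (mul_eq_zero.mp (by linarith : (A 0 0 - A 1 1) * B 1 0 = 0)).resolve_left h11
          |>.trans (by ring)
    · refine key (B 1 0 / A 1 0) ?_ (by field_simp) ?_
      · field_simp
        linarith
      · field_simp
        linarith
  · refine key (B 0 1 / A 0 1) (by field_simp) ?_ ?_
    · field_simp
      linarith
    · field_simp
      linarith

/-- The traceless part of a `2 × 2` matrix. -/
def Matrix.tracelessPart (A : Matrix (Fin 2) (Fin 2) ℝ) : Matrix (Fin 2) (Fin 2) ℝ :=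
  A - (A.trace / 2) • 1

theorem Matrix.trace_tracelessPart (A : Matrix (Fin 2) (Fin 2) ℝ) : A.tracelessPart.trace = 0 := by
  simp [Matrix.tracelessPart, Matrix.trace_fin_two]

/-- Two matrices with the same trace that commute with a nonscalar matrix have proportional
traceless parts. -/
theorem Matrix.exists_traceless_eq_smul_of_commute {h A B : Matrix (Fin 2) (Fin 2) ℝ}
    (hh : ∀ c : ℝ, h ≠ c • 1) (hA : ∀ c : ℝ, A ≠ c • 1) (hAB : A.trace = B.trace)
    (hcA : h * A = A * h) (hcB : h * B = B * h) :
    ∃ t : ℝ, B.tracelessPart = t • A.tracelessPart := by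
  rw [Matrix.tracelessPart, Matrix.tracelessPart, ← hAB]
  obtain ⟨α, β, rfl⟩ := Matrix.exists_eq_smul_one_add_smul_of_commute hh hcA
  obtain ⟨α', β', rfl⟩ := Matrix.exists_eq_smul_one_add_smul_of_commute hh hcB
  have hβ : β ≠ 0 := by
    rintro rfl
    exact hA α (by simp)
  refine ⟨β' / β, ?_⟩
  rw [Matrix.trace_fin_two, Matrix.trace_fin_two] at hAB
  simp at hAB
  ext i j
  fin_cases i <;> fin_cases j <;> simp [Matrix.trace_fin_two] <;> field_simp <;>
    first | linarith | linear_combination -β * hAB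

/-! ### Invariants and semi-invariants of a holomorphic map -/

namespace UpperHalfPlane

/-- The group of all automorphisms of the upper half-plane that leave `p` invariant. -/
def invariants (p : ℍ → ℍ) : Subgroup SL(2, ℝ) where
  carrier := {g | ∀ z, p (g • z) = p z}
  one_mem' z := by simp
  mul_mem' {g h} hg hh z := by rw [mul_smul, hg, hh]
  inv_mem' {g} hg z := by rw [← hg, smul_inv_smul]

/-- The group of all automorphisms of the upper half-plane that leave `p` invariant up to an
automorphism of the target. -/
def semiInvariants (p : ℍ → ℍ) : Subgroup SL(2, ℝ) where
  carrier := {h | ∃ g : PSL(2, ℝ), ∀ z, p (h • z) = g • p z}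
  one_mem' := ⟨1, fun z => by simp⟩
  mul_mem' {h h'} := fun ⟨g, hg⟩ ⟨g', hg'⟩ => ⟨g * g', fun z => by
    rw [mul_smul, hg, hg', mul_smul]⟩
  inv_mem' {h} := fun ⟨g, hg⟩ => ⟨g⁻¹, fun z => by rw [eq_inv_smul_iff, ← hg, smul_inv_smul]⟩

theorem conj_mem_invariants {p : ℍ → ℍ} {h k : SL(2, ℝ)} (hh : h ∈ semiInvariants p)
    (hk : k ∈ invariants p) : h * k * h⁻¹ ∈ invariants p := fun z => by
  obtain ⟨g, hg⟩ := hh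
  rw [mul_smul, mul_smul, hg, hk, ← hg, smul_inv_smul]

theorem eq_one_of_mem_center {g : SL(2, ℝ)} (hg : g ∈ Subgroup.center SL(2, ℝ))
    (h0 : 0 < g 0 0) : g = 1 := by
  obtain ⟨r, hr, hrg⟩ := Matrix.SpecialLinearGroup.mem_center_iff.mp hg
  have h00 : g 0 0 = r := by simp [← hrg]
  have hr2 : r ^ 2 = 1 := by simpa using hr
  have hr1 : r = 1 := by
    rw [h00] at h0
    nlinarith
  apply Subtype.ext
  rw [← hrg, hr1]
  simp

theorem eventually_apply_zero_zero_pos : ∀ᶠ g : SL(2, ℝ) in 𝓝 1, 0 < g 0 0 := by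
  have : Continuous fun g : SL(2, ℝ) => g 0 0 := by fun_prop
  exact this.continuousAt.eventually (lt_mem_nhds (by simp : (0 : ℝ) < (1 : SL(2, ℝ)) 0 0))

theorem eventually_eq_of_apply_eq {p : ℍ → ℍ} (hp : MDifferentiable 𝓘(ℂ) 𝓘(ℂ) p)
    (hne : ¬ ∃ w, ∀ z, p z = w) (a : ℍ) : ∀ᶠ z in 𝓝 a, p z = p a → z = a := by
  have hf : MDifferentiable 𝓘(ℂ) 𝓘(ℂ) (fun z => (p z : ℂ) - p a) := by
    rw [mdifferentiable_iff]
    exact (mdifferentiable_iff.mp (mdifferentiable_coe.comp hp)).sub_const _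
  have h : ¬ ∃ᶠ z in 𝓝[≠] a, (p z : ℂ) - p a = 0 := fun h =>
    hne ⟨p a, fun z => UpperHalfPlane.ext (sub_eq_zero.mp (congrFun (eq_zero_of_frequently hf h) z))⟩
  rw [not_frequently, eventually_nhdsWithin_iff] at h
  filter_upwards [h] with z hz hpz
  by_contra hza
  exact hz hza (by rw [hpz, sub_self])

/-- The group of automorphisms leaving a nonconstant holomorphic map invariant is discrete. -/
theorem eventually_eq_one_of_mem_invariants {p : ℍ → ℍ} (hp : MDifferentiable 𝓘(ℂ) 𝓘(ℂ) p)
    (hne : ¬ ∃ w, ∀ z, p z = w) : ∀ᶠ g in 𝓝 (1 : SL(2, ℝ)), g ∈ invariants p → g = 1 := by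
  obtain ⟨b, hb⟩ := exists_ne (I : ℍ)
  have h : ∀ a : ℍ, ∀ᶠ g in 𝓝 (1 : SL(2, ℝ)), g ∈ invariants p → g • a = a := fun a => by
    have hc : Tendsto (fun g : SL(2, ℝ) => g • a) (𝓝 1) (𝓝 a) := by
      have : Continuous fun g : SL(2, ℝ) => g • a := by fun_prop
      simpa using this.tendsto 1
    filter_upwards [hc.eventually (eventually_eq_of_apply_eq hp hne a)] with g hg hgp
    exact hg (hgp a)
  -- An invariant element close to 1 fixes two points, hence is ±1; the sign of the corner entry
  -- excludes -1.
  filter_upwards [h I, h b, eventually_apply_zero_zero_pos] with g h1 h2 h3 hg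
  exact eq_one_of_mem_center (PSLAction.mem_center_of_smul_eq hb (h2 hg) (h1 hg)) h3

/-- The commutator of h and k lies in the invariants, which h normalizes, and tends to 1 as h does.
The neighborhood depends on k. -/
theorem eventually_commute {p : ℍ → ℍ}
    (hK : ∀ᶠ g in 𝓝 (1 : SL(2, ℝ)), g ∈ invariants p → g = 1) {k : SL(2, ℝ)}
    (hk : k ∈ invariants p) :
    ∀ᶠ h in 𝓝 (1 : SL(2, ℝ)), h ∈ semiInvariants p → h * k = k * h := by
  have hc : Tendsto (fun h : SL(2, ℝ) => h * k * h⁻¹ * k⁻¹) (𝓝 1) (𝓝 1) := by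
    have : Continuous fun h : SL(2, ℝ) => h * k * h⁻¹ * k⁻¹ := by fun_prop
    simpa using this.tendsto 1
  filter_upwards [hc.eventually hK] with h hh hhN
  have := hh (mul_mem (conj_mem_invariants hhN hk) (inv_mem hk))
  rw [mul_inv_eq_one, mul_inv_eq_iff_eq_mul] at this
  exact this

theorem eventually_matrix {P : SL(2, ℝ) → Prop} (h : ∀ᶠ g in 𝓝 (1 : SL(2, ℝ)), P g) :
    ∀ᶠ M in 𝓝 (1 : Matrix (Fin 2) (Fin 2) ℝ), ∀ g : SL(2, ℝ), (g : Matrix _ _ ℝ) = M → P g := by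
  have h1 : IsInducing fun g : SL(2, ℝ) => (g : Matrix (Fin 2) (Fin 2) ℝ) :=
    Matrix.SpecialLinearGroup.isClosedEmbedding_val.isInducing
  rwa [h1.nhds_eq_comap, eventually_comap] at h

theorem _root_.Matrix.mul_self_of_trace_eq_zero {X : Matrix (Fin 2) (Fin 2) ℝ}
    (hX : X.trace = 0) : X * X = (-X.det) • 1 := by
  rw [Matrix.trace_fin_two] at hX
  have h : X 1 1 = -X 0 0 := by linarith
  rw [Matrix.det_fin_two]
  ext i j
  fin_cases i <;> fin_cases j <;> simp [Matrix.mul_apply, h] <;> ring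

theorem _root_.Matrix.det_smul_one_add_smul {X : Matrix (Fin 2) (Fin 2) ℝ}
    (hX : X.trace = 0) (a s : ℝ) : (a • 1 + s • X).det = a ^ 2 + s ^ 2 * X.det := by
  rw [Matrix.trace_fin_two] at hX
  have h : X 1 1 = -X 0 0 := by linarith
  rw [Matrix.det_fin_two, Matrix.det_fin_two]
  simp [h]
  ring

/-- An element normalizing a discrete group cannot contract the traceless part of an element of
that group. -/
theorem one_le_abs_of_mul_eq_smul_mul {K : Subgroup SL(2, ℝ)}
    (hK : ∀ᶠ g in 𝓝 (1 : SL(2, ℝ)), g ∈ K → g = 1) {k γ : SL(2, ℝ)} (hk : k ∈ K)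
    (hγ : ∀ g ∈ K, γ * g * γ⁻¹ ∈ K) {X : Matrix (Fin 2) (Fin 2) ℝ} {a t : ℝ}
    (hkX : (k : Matrix _ _ ℝ) = a • 1 + X) (hX : X.trace = 0) (hX0 : X ≠ 0)
    (h : (γ : Matrix _ _ ℝ) * X = t • (X * (γ : Matrix _ _ ℝ))) : 1 ≤ |t| := by
  by_contra! ht
  have hcancel : ∀ (n : ℕ) {A B : Matrix (Fin 2) (Fin 2) ℝ},
      A * (γ ^ n : SL(2, ℝ)) = B * (γ ^ n : SL(2, ℝ)) → A = B := fun n A B hAB => by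
    have := congrArg (fun M : Matrix (Fin 2) (Fin 2) ℝ => M * ((γ ^ n)⁻¹ : SL(2, ℝ))) hAB
    simpa only [mul_assoc, ← Matrix.SpecialLinearGroup.coe_mul, mul_inv_cancel,
      Matrix.SpecialLinearGroup.coe_one, mul_one] using this
  have ht0 : t ≠ 0 := by
    rintro rfl
    apply hX0
    have := congrArg (fun M : Matrix (Fin 2) (Fin 2) ℝ => (γ⁻¹ : SL(2, ℝ)) * M) h
    simpa only [← mul_assoc, ← Matrix.SpecialLinearGroup.coe_mul, inv_mul_cancel,
      Matrix.SpecialLinearGroup.coe_one, one_mul, zero_smul, mul_zero] using this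
  -- Determinants give det X = t² det X, so |t| < 1 forces X to be nilpotent and k to be ± a
  -- unipotent element.
  have hdet : X.det = 0 := by
    have h1 := congrArg Matrix.det h
    simp only [Matrix.det_mul, Matrix.det_smul, Fintype.card_fin,
      Matrix.SpecialLinearGroup.det_coe, one_mul, mul_one] at h1
    have h2 : t ^ 2 < 1 := by
      rw [← sq_abs]
      nlinarith [abs_nonneg t]
    have h3 : (1 - t ^ 2) * X.det = 0 := by linarith
    exact (mul_eq_zero.mp h3).resolve_left (by linarith)
  have ha : a ^ 2 = 1 := by
    have h1 := congrArg Matrix.det hkX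
    have h2 := Matrix.det_smul_one_add_smul hX a 1
    rw [one_smul] at h2
    rw [h2, hdet, Matrix.SpecialLinearGroup.det_coe] at h1
    linarith
  have hXX : X * X = 0 := by rw [Matrix.mul_self_of_trace_eq_zero hX, hdet]; simp
  have hpow : ∀ n : ℕ, ((γ ^ n : SL(2, ℝ)) : Matrix _ _ ℝ) * X =
      t ^ n • (X * ((γ ^ n : SL(2, ℝ)) : Matrix _ _ ℝ)) := fun n => by
    induction n with
    | zero => simp
    | succ n ih =>
      rw [pow_succ, Matrix.SpecialLinearGroup.coe_mul, mul_assoc, h, Matrix.mul_smul,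
        ← mul_assoc, ih, Matrix.smul_mul, smul_smul, mul_assoc, pow_succ, mul_comm]
  -- Squaring k removes the sign a = ±1: k² = 1 + 2aX, whose conjugates 1 + 2a tⁿ X are nontrivial
  -- and tend to 1.
  have hconj : ∀ n : ℕ, γ ^ n * (k * k) * (γ ^ n)⁻¹ ∈ K := fun n => by
    induction n with
    | zero => simpa using mul_mem hk hk
    | succ n ih => simpa [pow_succ', mul_assoc] using hγ _ ih
  have hval : ∀ n : ℕ, ((γ ^ n * (k * k) * (γ ^ n)⁻¹ : SL(2, ℝ)) : Matrix _ _ ℝ) =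
      1 + (2 * a * t ^ n) • X := fun n => by
    apply hcancel n
    rw [← Matrix.SpecialLinearGroup.coe_mul, inv_mul_cancel_right,
      Matrix.SpecialLinearGroup.coe_mul, Matrix.SpecialLinearGroup.coe_mul, hkX]
    have : (a • 1 + X) * (a • 1 + X) = 1 + (2 * a) • X := by
      rw [add_mul, mul_add, mul_add, hXX]
      simp only [Matrix.smul_mul, Matrix.mul_smul, one_mul, mul_one, smul_smul, add_zero]
      rw [← pow_two, ha, one_smul, add_assoc, ← add_smul, two_mul]
    rw [this, mul_add, add_mul, one_mul, mul_one, Matrix.mul_smul, hpow, Matrix.smul_mul,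
      smul_smul]
  have hlim : Tendsto (fun n : ℕ => (1 : Matrix (Fin 2) (Fin 2) ℝ) + (2 * a * t ^ n) • X) atTop
      (𝓝 1) := by
    have h1 := ((tendsto_pow_atTop_nhds_zero_of_abs_lt_one ht).const_mul (2 * a)).smul_const X
    simpa using h1.const_add (1 : Matrix (Fin 2) (Fin 2) ℝ)
  obtain ⟨n, hn⟩ := (hlim.eventually (eventually_matrix hK)).exists
  have h1 := hn _ (hval n) (hconj n)
  have h2 := hval n
  rw [h1, Matrix.SpecialLinearGroup.coe_one, left_eq_add, smul_eq_zero] at h2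
  refine h2.elim (fun h2 => ?_) hX0
  have : a ≠ 0 := by
    rintro rfl
    simp at ha
  exact absurd h2 (by positivity)

/-- A discrete group does not contain the squares of all elements of the one-parameter group
generated by a nonzero traceless matrix `X`. -/
theorem exists_mul_self_notMem {K : Subgroup SL(2, ℝ)}
    (hK : ∀ᶠ g in 𝓝 (1 : SL(2, ℝ)), g ∈ K → g = 1) {X : Matrix (Fin 2) (Fin 2) ℝ}
    (hX : X.trace = 0) (hX0 : X ≠ 0) :
    ∃ (c : SL(2, ℝ)) (b s : ℝ), (c : Matrix _ _ ℝ) = b • 1 + s • X ∧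
      ((c⁻¹ : SL(2, ℝ)) : Matrix _ _ ℝ) = b • 1 - s • X ∧ c * c ∉ K := by
  have hcont : Continuous fun s : ℝ => (√(1 - s ^ 2 * X.det) • (1 : Matrix (Fin 2) (Fin 2) ℝ) +
      s • X) * (√(1 - s ^ 2 * X.det) • 1 + s • X) := by fun_prop
  have hlim := hcont.tendsto 0
  simp only [ne_eq, OfNat.ofNat_ne_zero, not_false_eq_true, zero_pow, zero_mul, sub_zero,
    Real.sqrt_one, one_smul, zero_smul, add_zero, mul_one] at hlim
  have hpos : ∀ᶠ s : ℝ in 𝓝 0, 0 < 1 - s ^ 2 * X.det := by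
    have : Continuous fun s : ℝ => 1 - s ^ 2 * X.det := by fun_prop
    exact this.continuousAt.eventually (lt_mem_nhds (by simp))
  have hev := (hlim.eventually (eventually_matrix hK)).and hpos
  obtain ⟨s, ⟨h1, h2⟩, hs⟩ := ((hev.filter_mono nhdsWithin_le_nhds).and
    (self_mem_nhdsWithin : {0}ᶜ ∈ 𝓝[≠] (0 : ℝ))).exists
  -- This b makes det(b + sX) = 1, so that the inverse is b - sX. If c² = 1 then c = c⁻¹, i.e. 2sX =
  -- 0.
  set b := √(1 - s ^ 2 * X.det) with hb
  have hdet : (b • (1 : Matrix (Fin 2) (Fin 2) ℝ) + s • X).det = 1 := by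
    rw [Matrix.det_smul_one_add_smul hX, hb, Real.sq_sqrt h2.le]
    ring
  obtain ⟨c, hc⟩ : ∃ c : SL(2, ℝ), (c : Matrix (Fin 2) (Fin 2) ℝ) = b • 1 + s • X :=
    ⟨⟨_, hdet⟩, rfl⟩
  have hinv : ((c⁻¹ : SL(2, ℝ)) : Matrix (Fin 2) (Fin 2) ℝ) = b • 1 - s • X := by
    rw [Matrix.trace_fin_two] at hX
    have h11 : X 1 1 = -X 0 0 := by linarith
    rw [Matrix.SpecialLinearGroup.coe_inv, hc, Matrix.adjugate_fin_two]
    ext i j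
    fin_cases i <;> fin_cases j <;> simp [h11]
    ring
  refine ⟨c, b, s, hc, hinv, fun hmem => ?_⟩
  have h3 := h1 (c * c) (by rw [Matrix.SpecialLinearGroup.coe_mul, hc]) hmem
  have h4 := congrArg (fun g : SL(2, ℝ) => (g : Matrix (Fin 2) (Fin 2) ℝ))
    (mul_eq_one_iff_eq_inv.mp h3)
  simp only [hc, hinv] at h4
  have h5 : (2 * s) • X = 0 := by
    have : (b • (1 : Matrix (Fin 2) (Fin 2) ℝ) + s • X) - (b • 1 - s • X) = 0 := sub_eq_zero.mpr h4
    rw [← this, two_mul, add_smul]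
    abel
  rcases smul_eq_zero.mp h5 with h6 | h6
  · exact hs (by simpa using h6)
  · exact hX0 h6

theorem mem_center_of_eq_smul_one {g : SL(2, ℝ)} {c : ℝ}
    (hg : (g : Matrix (Fin 2) (Fin 2) ℝ) = c • 1) : g ∈ Subgroup.center SL(2, ℝ) := by
  refine Subgroup.mem_center_iff.mpr fun h => Subtype.ext ?_
  rw [Matrix.SpecialLinearGroup.coe_mul, Matrix.SpecialLinearGroup.coe_mul, hg]
  simp

/-- If the semi-invariants of `p` accumulate at the identity, conjugation by any semi-invariant
element scales the traceless part of any invariant element. -/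
theorem exists_mul_eq_smul_mul_of_frequently {p : ℍ → ℍ}
    (hK : ∀ᶠ g in 𝓝 (1 : SL(2, ℝ)), g ∈ invariants p → g = 1)
    (hN : ∃ᶠ h in 𝓝 (1 : SL(2, ℝ)), h ∈ semiInvariants p ∧ h ≠ 1) {k γ : SL(2, ℝ)}
    (hk : k ∈ invariants p) (hkc : k ∉ Subgroup.center SL(2, ℝ)) (hγ : γ ∈ semiInvariants p) :
    ∃ t : ℝ, (γ : Matrix (Fin 2) (Fin 2) ℝ) * (k : Matrix (Fin 2) (Fin 2) ℝ).tracelessPart =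
      t • ((k : Matrix (Fin 2) (Fin 2) ℝ).tracelessPart * (γ : Matrix (Fin 2) (Fin 2) ℝ)) := by
  have hk2 := conj_mem_invariants hγ hk
  -- A single nonscalar h commutes with both k and γkγ⁻¹, so both lie in its two-dimensional
  -- centralizer.
  obtain ⟨h, ⟨hhN, hh1⟩, hc1, hc2, hpos⟩ := (hN.and_eventually ((eventually_commute hK hk).and
    ((eventually_commute hK hk2).and eventually_apply_zero_zero_pos))).exists
  have htr : (k : Matrix (Fin 2) (Fin 2) ℝ).trace =
      ((γ * k * γ⁻¹ : SL(2, ℝ)) : Matrix (Fin 2) (Fin 2) ℝ).trace := by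
    rw [Matrix.SpecialLinearGroup.coe_mul, Matrix.trace_mul_comm,
      ← Matrix.SpecialLinearGroup.coe_mul, inv_mul_cancel_left]
  obtain ⟨t, ht⟩ := Matrix.exists_traceless_eq_smul_of_commute
    (fun c hc => hh1 (eq_one_of_mem_center (mem_center_of_eq_smul_one hc) hpos))
    (fun c hc => hkc (mem_center_of_eq_smul_one hc)) htr
    (congrArg (fun g : SL(2, ℝ) => (g : Matrix (Fin 2) (Fin 2) ℝ)) (hc1 hhN))
    (congrArg (fun g : SL(2, ℝ) => (g : Matrix (Fin 2) (Fin 2) ℝ)) (hc2 hhN))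
  refine ⟨t, ?_⟩
  rw [← Matrix.smul_mul, ← ht, Matrix.tracelessPart, Matrix.tracelessPart, ← htr, sub_mul, ← Matrix.SpecialLinearGroup.coe_mul,
    inv_mul_cancel_right, mul_sub, Matrix.SpecialLinearGroup.coe_mul]
  simp

/-- Neither γ nor γ⁻¹ can contract X, and their scaling factors are inverse to each other, so both
have absolute value 1. -/
theorem eq_one_or_eq_neg_one_of_frequently {p : ℍ → ℍ}
    (hK : ∀ᶠ g in 𝓝 (1 : SL(2, ℝ)), g ∈ invariants p → g = 1)
    (hN : ∃ᶠ h in 𝓝 (1 : SL(2, ℝ)), h ∈ semiInvariants p ∧ h ≠ 1) {k γ : SL(2, ℝ)}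
    (hk : k ∈ invariants p) (hkc : k ∉ Subgroup.center SL(2, ℝ)) (hγ : γ ∈ semiInvariants p)
    {X : Matrix (Fin 2) (Fin 2) ℝ} (hX : X = (k : Matrix (Fin 2) (Fin 2) ℝ).tracelessPart) :
    (γ : Matrix (Fin 2) (Fin 2) ℝ) * X = X * γ ∨ (γ : Matrix (Fin 2) (Fin 2) ℝ) * X = -(X * γ) := by
  have htr : X.trace = 0 := hX ▸ Matrix.trace_tracelessPart _
  have hX0 : X ≠ 0 := fun h0 => hkc (mem_center_of_eq_smul_one (sub_eq_zero.mp (hX ▸ h0)))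
  have hkX : (k : Matrix (Fin 2) (Fin 2) ℝ) = ((k : Matrix (Fin 2) (Fin 2) ℝ).trace / 2) • 1 + X := by
    rw [hX, Matrix.tracelessPart, add_sub_cancel]
  obtain ⟨t, ht⟩ := exists_mul_eq_smul_mul_of_frequently hK hN hk hkc hγ
  obtain ⟨t', ht'⟩ := exists_mul_eq_smul_mul_of_frequently hK hN hk hkc (inv_mem hγ)
  rw [← hX] at ht ht'
  have h1 := one_le_abs_of_mul_eq_smul_mul hK hk (fun g hg => conj_mem_invariants hγ hg) hkX
    htr hX0 ht
  have h2 := one_le_abs_of_mul_eq_smul_mul hK hk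
    (fun g hg => conj_mem_invariants (inv_mem hγ) hg) hkX htr hX0 ht'
  have h3 : (1 - t * t') • X = 0 := by
    have h4 : (γ : Matrix (Fin 2) (Fin 2) ℝ) * ((γ⁻¹ : SL(2, ℝ)) * X) = X := by
      rw [← mul_assoc, ← Matrix.SpecialLinearGroup.coe_mul, mul_inv_cancel,
        Matrix.SpecialLinearGroup.coe_one, one_mul]
    rw [ht', Matrix.mul_smul, ← mul_assoc, ht, Matrix.smul_mul, mul_assoc,
      ← Matrix.SpecialLinearGroup.coe_mul, mul_inv_cancel, Matrix.SpecialLinearGroup.coe_one,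
      mul_one, smul_smul] at h4
    rw [sub_smul, one_smul, mul_comm, h4, sub_self]
  have h5 : t * t' = 1 := by linarith [(smul_eq_zero.mp h3).resolve_right hX0]
  have h6 : |t| * |t'| = 1 := by rw [← abs_mul, h5, abs_one]
  have h7 : |t| = 1 := by nlinarith
  rcases (abs_eq zero_le_one).mp h7 with h | h
  · left
    rw [ht, h, one_smul]
  · right
    rw [ht, h, neg_one_smul]

end UpperHalfPlane

/-! ### Discreteness of the semi-invariants -/

namespace ModularEmbedding

open UpperHalfPlane

variable {E : ModularEmbedding}

theorem mem_semiInvariants_of_mem_dom {γ : SL(2, ℝ)} (hγ : (γ : PSL(2, ℝ)) ∈ E.dom) :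
    γ ∈ semiInvariants E.p := ⟨E.rho ⟨γ, hγ⟩, E.equivariant ⟨γ, hγ⟩⟩

/-- Equivariance turns an element of ker ρ into an invariant of p; this is how the kernel enters the
argument. -/
theorem exists_mem_invariants_notMem_center (hker : E.rho.ker ≠ ⊥) :
    ∃ k ∈ invariants E.p, k ∉ Subgroup.center SL(2, ℝ) := by
  obtain ⟨⟨⟨x, hx⟩, hx1⟩, hne⟩ := Subgroup.ne_bot_iff_exists_ne_one.mp hker
  obtain ⟨k, rfl⟩ := QuotientGroup.mk_surjective x
  refine ⟨k, fun z => ?_, fun hk => hne (Subtype.ext (Subtype.ext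
    ((QuotientGroup.eq_one_iff k).mpr hk)))⟩
  have := E.equivariant ⟨_, hx⟩ z
  rw [MonoidHom.mem_ker.mp hx1, one_smul] at this
  exact this

/-- The automorphisms under which `p` is semi-invariant form a discrete group, if `p` is
nonconstant and `ρ` is not injective. -/
theorem eventually_eq_one_of_mem_semiInvariants (hp : ¬ ∃ w, ∀ z, E.p z = w)
    (hker : E.rho.ker ≠ ⊥) :
    ∀ᶠ h in 𝓝 (1 : SL(2, ℝ)), h ∈ semiInvariants E.p → h = 1 := by
  by_contra hN
  rw [not_eventually] at hN
  replace hN : ∃ᶠ h in 𝓝 (1 : SL(2, ℝ)), h ∈ semiInvariants E.p ∧ h ≠ 1 :=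
    hN.mono fun h hh => by simpa using hh
  have hK := eventually_eq_one_of_mem_invariants E.holomorphic hp
  obtain ⟨k, hk, hkc⟩ := exists_mem_invariants_notMem_center hker
  obtain ⟨X, hX⟩ : ∃ X : Matrix (Fin 2) (Fin 2) ℝ,
    X = (k : Matrix (Fin 2) (Fin 2) ℝ).tracelessPart := ⟨_, rfl⟩
  have htr : X.trace = 0 := hX ▸ Matrix.trace_tracelessPart _
  have hX0 : X ≠ 0 := fun h0 => hkc (mem_center_of_eq_smul_one (sub_eq_zero.mp (hX ▸ h0)))
  obtain ⟨c, b, s, hc, hci, hcK⟩ := exists_mul_self_notMem hK htr hX0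
  have hcomm : ∀ γ ∈ semiInvariants E.p, γ * c = c * γ ∨ γ * c = c⁻¹ * γ := fun γ hγ => by
    rcases eq_one_or_eq_neg_one_of_frequently hK hN hk hkc hγ hX with h | h
    · refine .inl (Subtype.ext ?_)
      rw [Matrix.SpecialLinearGroup.coe_mul, Matrix.SpecialLinearGroup.coe_mul, hc, mul_add,
        add_mul, Matrix.mul_smul, Matrix.mul_smul, h]
      simp
    · refine .inr (Subtype.ext ?_)
      rw [Matrix.SpecialLinearGroup.coe_mul, Matrix.SpecialLinearGroup.coe_mul, hc, hci, mul_add,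
        sub_mul, Matrix.mul_smul, Matrix.mul_smul, h]
      simp [sub_eq_add_neg]
  obtain ⟨-, F, hF, hvol⟩ := E.isLattice
  have := E.isLattice.countable
  -- An element γ of Γ either preserves or exchanges the two maps up to the isometry g of the
  -- target, so their distance is invariant. Equality of the maps puts c² among the invariants.
  have heq := eq_of_dist_invariant hF hvol (p := fun z => E.p (c • z))
    (q := fun z => E.p (c⁻¹ • z))
    (E.holomorphic.comp (PSLAction.mdifferentiable (c : PSL(2, ℝ))))
    (E.holomorphic.comp (PSLAction.mdifferentiable ((c⁻¹ : SL(2, ℝ)) : PSL(2, ℝ)))) ?_ ?_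
  · refine hcK fun z => ?_
    have := congrFun heq (c • z)
    simp only [inv_smul_smul] at this
    rw [mul_smul, this]
  · intro γ hγ z
    obtain ⟨γ, rfl⟩ := QuotientGroup.mk_surjective γ
    change dist (E.p (c • γ • z)) (E.p (c⁻¹ • γ • z)) = _
    have hγN := mem_semiInvariants_of_mem_dom hγ
    obtain ⟨g, hg⟩ := id hγN
    rcases hcomm γ hγN with h | h
    · have h' : c⁻¹ * γ = γ * c⁻¹ := by
        rw [inv_mul_eq_iff_eq_mul, ← mul_assoc, ← h, mul_inv_cancel_right]
      rw [smul_smul, smul_smul, ← h, h', mul_smul, mul_smul, hg, hg, dist_smul]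
    · have h' : c * γ = γ * c⁻¹ := by
        rw [eq_mul_inv_iff_mul_eq, mul_assoc, h, mul_inv_cancel_left]
      rw [smul_smul, smul_smul, ← h, h', mul_smul, mul_smul, hg, hg, dist_smul, dist_comm]
  · rintro ⟨w, hw⟩
    exact hp ⟨w, fun z => by simpa using hw (c⁻¹ • z)⟩

end ModularEmbedding

/-! ### Finite index by comparison of areas -/

/-- A group `H` containing a group of finite covolume contains it with finite index, if only
finitely many elements of `H` return some set of positive measure to itself. -/
theorem MeasureTheory.IsFundamentalDomain.relIndex_ne_zero {G α : Type*} [Group G]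
    [MulAction G α] [MeasurableSpace α] {μ : Measure α} [MeasurableConstSMul G α]
    [SMulInvariantMeasure G α μ] {Γ H : Subgroup G} [Countable Γ] (hle : Γ ≤ H)
    {F : Set α} (hF : IsFundamentalDomain Γ F μ) (hfin : μ F ≠ ⊤) {U : Set α}
    (hU : MeasurableSet U) (hU0 : μ U ≠ 0)
    (hS : {h : G | h ∈ H ∧ (h • U ∩ U).Nonempty}.Finite) : Γ.relIndex H ≠ 0 := by
  intro hind
  set S := {h : G | h ∈ H ∧ (h • U ∩ U).Nonempty} with hSdef
  have hinf : Infinite (H ⧸ Γ.subgroupOf H) := Subgroup.index_eq_zero_iff_infinite.mp hind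
  have hbound : ∀ s : Finset (H ⧸ Γ.subgroupOf H), s.card * μ U ≤ S.ncard * μ F := by
    intro s
    set r : H ⧸ Γ.subgroupOf H → G := fun q => ((q.out)⁻¹ : H) with hr
    have hrH : ∀ q, r q ∈ H := fun q => Subtype.property _
    -- Distinct pairs (coset, γ) give distinct elements of H, so the overlap of the translates of U
    -- at a point is at most the number of returns.
    have hinj : Function.Injective fun x : s × Γ => (x.2 : G) * r x.1 := by
      rintro ⟨⟨q, hq⟩, γ⟩ ⟨⟨q', hq'⟩, γ'⟩ h
      simp only at h
      have h1 : q = q' := by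
        rw [← q.out_eq', ← q'.out_eq']
        refine QuotientGroup.eq.mpr ?_
        rw [Subgroup.mem_subgroupOf]
        have h2 : ((q.out⁻¹ * q'.out : H) : G) = (γ : G)⁻¹ * γ' := by
          have : r q * (r q')⁻¹ = (γ : G)⁻¹ * γ' := by
            rw [eq_inv_mul_iff_mul_eq, ← mul_assoc, h, mul_inv_cancel_right]
          simpa [hr] using this
        rw [h2]
        exact mul_mem (inv_mem γ.2) γ'.2
      subst h1
      simpa using h
    have hcount : ∀ x : α, ∑' y : s × Γ, (((y.2 : G) * r y.1) • U).indicator 1 x ≤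
        (S.ncard : ENNReal) := by
      intro x
      by_cases hx : ∃ y₀ : s × Γ, x ∈ ((y₀.2 : G) * r y₀.1) • U
      · obtain ⟨y₀, hy₀⟩ := hx
        set g₀ := (y₀.2 : G) * r y₀.1
        have hg₀ : g₀ ∈ H := mul_mem (hle y₀.2.2) (hrH _)
        set A := {y : s × Γ | x ∈ ((y.2 : G) * r y.1) • U}
        have hmap : Set.MapsTo (fun y : s × Γ => g₀⁻¹ * ((y.2 : G) * r y.1)) A S := by
          intro y hy
          refine ⟨mul_mem (inv_mem hg₀) (mul_mem (hle y.2.2) (hrH _)), g₀⁻¹ • x, ?_, ?_⟩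
          · rw [mul_smul]
            exact Set.smul_mem_smul_set hy
          · exact Set.mem_smul_set_iff_inv_smul_mem.mp hy₀
        have hinj' : Set.InjOn (fun y : s × Γ => g₀⁻¹ * ((y.2 : G) * r y.1)) A :=
          fun y _ y' _ h => hinj (mul_left_cancel h)
        have hA : A.encard ≤ S.encard := Set.encard_le_encard_of_injOn hmap hinj'
        calc ∑' y : s × Γ, (((y.2 : G) * r y.1) • U).indicator 1 x
            = ∑' y : s × Γ, A.indicator (fun _ => (1 : ENNReal)) y := rfl
          _ = ∑' y : A, (1 : ENNReal) := (tsum_subtype A _).symm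
          _ = (A.encard : ENNReal) := ENNReal.tsum_set_one A
          _ ≤ (S.encard : ENNReal) := by exact_mod_cast hA
          _ = S.ncard := by rw [← hS.cast_ncard_eq]; rfl
      · push Not at hx
        simp [Set.indicator, hx]
    calc s.card * μ U = ∑ q : s, μ (r q • U) := by
          simp only [measure_smul, Finset.sum_const, nsmul_eq_mul]
          simp
      _ = ∑ q : s, ∑' γ : Γ, μ ((γ • r q • U) ∩ F) :=
          Finset.sum_congr rfl fun q _ => hF.measure_eq_tsum _
      _ = ∑' y : s × Γ, μ ((((y.2 : G) * r y.1) • U) ∩ F) := by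
          rw [ENNReal.tsum_prod (f := fun q γ => μ ((((γ : Γ) : G) * r (q : s)) • U ∩ F)),
            tsum_fintype]
          refine Finset.sum_congr rfl fun q _ => tsum_congr fun γ => ?_
          rw [mul_smul]
          rfl
      _ = ∑' y : s × Γ, ∫⁻ x in F, (((y.2 : G) * r y.1) • U).indicator 1 x ∂μ := by
          refine tsum_congr fun y => ?_
          rw [lintegral_indicator_one (hU.const_smul _),
            Measure.restrict_apply (hU.const_smul _)]
      _ = ∫⁻ x in F, ∑' y : s × Γ, (((y.2 : G) * r y.1) • U).indicator 1 x ∂μ :=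
          (lintegral_tsum fun y =>
            (measurable_one.indicator (hU.const_smul _)).aemeasurable).symm
      _ ≤ ∫⁻ _ in F, (S.ncard : ENNReal) ∂μ := lintegral_mono hcount
      _ = S.ncard * μ F := setLIntegral_const _ _
  -- Infinitely many cosets would allow n of them with n μ(U) > |S| μ(F), against `hbound`.
  obtain ⟨n, hn⟩ := ENNReal.exists_nat_mul_gt hU0
    (ENNReal.mul_ne_top (ENNReal.natCast_ne_top S.ncard) hfin)
  obtain ⟨s, hs⟩ := Infinite.exists_subset_card_eq (H ⧸ Γ.subgroupOf H) n
  exact absurd (hbound s) (by rw [hs]; exact not_le.mpr hn)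

namespace ModularEmbedding

open UpperHalfPlane

variable {E : ModularEmbedding}

/-- A discrete subgroup of `SL(2, ℝ)` acts properly discontinuously on ℍ; the returns of compact
discs are counted for N and then mapped to `PSL(2, ℝ)`. -/
theorem finite_returns (hp : ¬ ∃ w, ∀ z, E.p z = w) (hker : E.rho.ker ≠ ⊥) (R : ℝ) :
    {h : PSL(2, ℝ) | (∃ g : PSL(2, ℝ), ∀ z, E.p (h • z) = g • E.p z) ∧
      (h • Metric.ball (I : ℍ) R ∩ Metric.ball (I : ℍ) R).Nonempty}.Finite := by
  have hdisc : DiscreteTopology (semiInvariants E.p) := by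
    refine discreteTopology_of_isOpen_singleton_one ?_
    obtain ⟨V, hV, hVo, h1⟩ := eventually_nhds_iff.mp
      (eventually_eq_one_of_mem_semiInvariants hp hker)
    refine ⟨V, hVo, ?_⟩
    ext x
    constructor
    · intro hx
      exact Subtype.ext (hV x hx x.2)
    · rintro rfl
      exact h1
  have hfin := ProperlyDiscontinuousSMul.finite_disjoint_inter_image
    (Γ := semiInvariants E.p) (isCompact_closedBall (I : ℍ) R) (isCompact_closedBall (I : ℍ) R)
  refine (hfin.image fun h : semiInvariants E.p => ((h : SL(2, ℝ)) : PSL(2, ℝ))).subset ?_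
  rintro h ⟨hh, z, hz1, hz2⟩
  obtain ⟨h, rfl⟩ := QuotientGroup.mk_surjective h
  refine ⟨⟨h, hh⟩, ⟨z, ?_, Metric.ball_subset_closedBall hz2⟩, rfl⟩
  obtain ⟨w, hw, rfl⟩ := hz1
  exact ⟨w, Metric.ball_subset_closedBall hw, rfl⟩

theorem relIndex_range_snd_ne_zero (hp : ¬ ∃ w, ∀ z, E.p z = w) (hker : E.rho.ker ≠ ⊥) :
    E.dom.relIndex ((MonoidHom.snd PSL(2, ℝ) PSL(2, ℝ)).comp E.comm.subtype).range ≠ 0 := by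
  obtain ⟨-, F, hF, hvol⟩ := E.isLattice
  have := E.isLattice.countable
  refine hF.relIndex_ne_zero (fun γ hγ => ⟨⟨_, domEmb_range_le_comm E ⟨⟨γ, hγ⟩, rfl⟩⟩, rfl⟩)
    hvol.ne (U := Metric.ball I 1) Metric.isOpen_ball.measurableSet
    (Metric.isOpen_ball.measure_pos volume ⟨I, Metric.mem_ball_self one_pos⟩).ne'
    ((finite_returns hp hker 1).subset ?_)
  rintro _ ⟨⟨x, rfl⟩, hx⟩
  exact ⟨⟨(x : PSL(2, ℝ) × PSL(2, ℝ)).1, p_smul_of_mem_comm hp x.2⟩, hx⟩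

end ModularEmbedding

end

theorem proposition4 (E : ModularEmbedding)
    (hp : ¬ ∃ w : ℍ, ∀ z : ℍ, E.p z = w)
    (hker : E.rho.ker ≠ ⊥) :
    E.domEmb.range ≤ E.comm ∧ (E.domEmb.range.subgroupOf E.comm).FiniteIndex := by
  refine ⟨E.domEmb_range_le_comm, ⟨?_⟩⟩
  rw [ModularEmbedding.domEmb_range_subgroupOf_comm hp, Subgroup.index_comap]
  exact ModularEmbedding.relIndex_range_snd_ne_zero hp hker
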